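/- Let $\mathcal O$ be a compact discrete valuation ring of characteristic $0$ with uniformizer $\pi$ and residue field of cardinality $q$, and let $n\ge 2$. Let $A$ be an $n$-dimensional $\mathcal O$-algebra, i.e. the module $\mathcal O^n$ with an arbitrary $\mathcal O$-bilinear multiplication (not necessarily associative, commutative or unital), and assume that $A$ is graded: $A=\bigoplus_{j\ge 1}A_j$ with free $\mathcal O$-submodules $A_j$ such that $A_k\cdot A_l\subseteq A_{k+l}$ for all $k,l\ge1$. A lattice is an $\mathcal O$-submodule $\Lambda\le\mathcal O^n$ of rank $n$. It is primitive if $\pi^{-1}\Lambda\not\subseteq\mathcal O^n$. Its weight is $w(\Lambda)=\min\{w\in\mathbb N \mid \pi^w\Lambda \text{ is closed under the multiplication of } A\}$. Let $\lambda_1\ge\dots\ge\lambda_n\ge 0$ be the exponents of the elementary divisors of $\Lambda$: there is a basis $b_1,\dots,b_n$ of $\mathcal O^n$ such that $\pi^{\lambda_1}b_1,\dots,\pi^{\lambda_n}b_n$ span $\Lambda$. The elementary divisor type of a primitive lattice $\Lambda$ is the pair $(I,\overline r)$, where $I=\{\iota\in\{1,\dots,n-1\}\mid\lambda_\iota>\lambda_{\iota+1}\}$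 and $\overline r=(r_\iota)_{\iota\in I}$ with $r_\iota=\lambda_\iota-\lambda_{\iota+1}$. Fix $I\subseteq\{1,\dots,n-1\}$ and positive integers $\overline r=(r_\iota)_{\iota\in I}$, and put $R=\max_{\iota\in I}r_\iota$ (with $R=0$ if $I=\emptyset$). For $w\in\mathbb N$ let $\tilde a^w_{q^{I\cdot\overline r}}(A)$ be the number of primitive lattices of elementary divisor type $(I,\overline r)$ and weight $w$. Then for every $w\in\mathbb N$ this number is finite and $$v_q\left(\tilde a^w_{q^{I\cdot\overline r}}(A)\right)\ \ge\ \left\lfloor\frac{R+w}{2(n-1)}\right\rfloor ,$$ where $v_q(a)=\max\{m\in\mathbb N : q^m\mid a\}$ for an integer $a\neq0$ and $v_q(0)=\infty$. -/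

import Mathlib

open scoped Pointwise

/-- The lattice `Λ` is closed under the multiplication `mul`. -/
def IsClosedUnderMul {O : Type*} [CommRing O] {n : ℕ}
    (mul : (Fin n → O) →ₗ[O] (Fin n → O) →ₗ[O] (Fin n → O))
    (Λ : Submodule O (Fin n → O)) : Prop :=
  ∀ x ∈ Λ, ∀ y ∈ Λ, mul x y ∈ Λ

/-- The algebra structure `mul` on `O ^ n` is graded: `O ^ n` is an internal direct sum of free
submodules `𝒜 j`, `j = 1, 2, 3, …`, with `𝒜 k * 𝒜 l ⊆ 𝒜 (k + l)`. -/
def IsGradedMul {O : Type*} [CommRing O] {n : ℕ}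
    (mul : (Fin n → O) →ₗ[O] (Fin n → O) →ₗ[O] (Fin n → O)) : Prop :=
  ∃ 𝒜 : ℕ+ → Submodule O (Fin n → O),
    DirectSum.IsInternal 𝒜 ∧
    (∀ j, Module.Free O (𝒜 j)) ∧
    ∀ k l : ℕ+, ∀ x ∈ 𝒜 k, ∀ y ∈ 𝒜 l, mul x y ∈ 𝒜 (k + l)

/-- `Λ ≤ O ^ n` is a sublattice of full rank. -/
def IsFullLattice {O : Type*} [CommRing O] {n : ℕ} (Λ : Submodule O (Fin n → O)) : Prop :=
  Module.finrank O Λ = n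

/-- `Λ` is primitive: `ϖ⁻¹ Λ` is not contained in `O ^ n`, i.e. `Λ` is not contained in
`ϖ O ^ n`. -/
def IsPrimitiveLattice {O : Type*} [CommRing O] (ϖ : O) {n : ℕ}
    (Λ : Submodule O (Fin n → O)) : Prop :=
  ¬ Λ ≤ ϖ • (⊤ : Submodule O (Fin n → O))

/-- The weight of `Λ` is `w`: the least `k` such that `ϖ ^ k Λ` is closed under multiplication. -/
def HasWeight {O : Type*} [CommRing O] (ϖ : O) {n : ℕ}
    (mul : (Fin n → O) →ₗ[O] (Fin n → O) →ₗ[O] (Fin n → O))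
    (Λ : Submodule O (Fin n → O)) (w : ℕ) : Prop :=
  IsLeast {k : ℕ | IsClosedUnderMul mul (ϖ ^ k • Λ)} w

/-- The elementary divisors of `Λ` are `ϖ ^ lam 1, …, ϖ ^ lam n`, with
`lam 1 ≥ lam 2 ≥ … ≥ lam n`: for some basis `b` of `O ^ n`, the lattice `Λ` is the span of the
vectors `ϖ ^ lam 1 b₁, …, ϖ ^ lam n bₙ`. (Only the values of `lam` on `{1, …, n}` matter; the
index set `Fin n` starts at `0`, whence the shift.) -/
def HasElementaryDivisors {O : Type*} [CommRing O] (ϖ : O) {n : ℕ}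
    (Λ : Submodule O (Fin n → O)) (lam : ℕ → ℕ) : Prop :=
  AntitoneOn lam (Set.Icc 1 n) ∧
  ∃ b : Module.Basis (Fin n) O (Fin n → O),
    Λ = Submodule.span O (Set.range fun i : Fin n => ϖ ^ lam (i.val + 1) • b i)

/-- `Λ` has elementary divisor type `(I, r)`: with `lam` the exponents of its elementary divisors,
`I = {ι ∈ {1, …, n - 1} : lam ι > lam (ι + 1)}` and `r ι = lam ι - lam (ι + 1)` for `ι ∈ I`. -/
def HasElementaryDivisorType {O : Type*} [CommRing O] (ϖ : O) {n : ℕ}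
    (Λ : Submodule O (Fin n → O)) (I : Finset ℕ) (r : ℕ → ℕ) : Prop :=
  ∃ lam : ℕ → ℕ, HasElementaryDivisors ϖ Λ lam ∧
    (∀ ι : ℕ, ι ∈ I ↔ ι ∈ Finset.Icc 1 (n - 1) ∧ lam (ι + 1) < lam ι) ∧
    ∀ ι ∈ I, lam ι = lam (ι + 1) + r ι

/-- The set of primitive lattices of type `(I, r)` and weight `w`. -/
def primitiveLattices {O : Type*} [CommRing O] (ϖ : O) {n : ℕ}
    (mul : (Fin n → O) →ₗ[O] (Fin n → O) →ₗ[O] (Fin n → O))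
    (I : Finset ℕ) (r : ℕ → ℕ) (w : ℕ) : Set (Submodule O (Fin n → O)) :=
  {Λ | IsFullLattice Λ ∧ IsPrimitiveLattice ϖ Λ ∧ HasElementaryDivisorType ϖ Λ I r ∧
    HasWeight ϖ mul Λ w}

/-!
The primitive lattices `Λ` of given type and weight `w` are partitioned into classes whose sizes
are multiples of `q ^ m`, where `m` is the claimed exponent. Each class is an orbit of a group
`1 + J`, where `J` is a module of endomorphisms of `O ^ n` closed under composition. Such an orbit
has as many elements as the finite `O`-module `J / (J ∩ End Λ)`
(`IsQuasiInvertible.ncard_unipotentOrbit`), and the size of a finite `O`-module is a multiple of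
`q ^ m` as soon as it has an element not killed by `ϖ ^ (m - 1)`
(`card_residueField_pow_dvd_card`). As `1 + J` acts by automorphisms of `O ^ n`, only the weight has
to be watched.

The grading is used through a homogeneous basis ordered by degree: its flag
`F 0 = O ^ n, F 1, …, F n = 0` satisfies `A * F k + F k * A ⊆ F (k + 1)`
(`exists_shiftsFlag_of_isGradedMul`). Relative to this flag `Λ` has two sequences of exponents: the
largest `α k` with `Λ ⊆ F k + ϖ ^ (α k) A` (`topExp`), and the least `β k` with
`ϖ ^ (β k) F k ⊆ Λ` (`tailExp`). For `J` one takes the endomorphisms that vanish on `F i` and map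
into `ϖ ^ a F j`, with `a = β j - α i - m`; the generic one then moves `Λ` by exactly `ϖ ^ m`
(`IsAdmissible.pow_dvd_ncard`). Because products descend in the flag, such moves change the product
on `Λ` by little: if `α (i - 1)` is large compared to `α i`, if `β j` is large compared to
`β (j + 1)`, and if `β j - α i` is large, then the weight is preserved
(`IsAdmissible.hasWeight_map`).

Let `i` be the last index and `j` the first index where `α` and `β` drop by enough. Before `j` the
sequence `β` decreases slowly, so `β j` is close to `β 0`, which is at least `max r` and at least
`w`; and after `i` the sequence `α` ends with `α n = 0` without large drops, so `α i` is small.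
This yields the remaining conditions when `2 (n - 1) m ≤ max r + w` (`gap_of_extremal_indices`).
Finally the choice of `(i, j)`, and the exponent `a`, are the same for all lattices in the orbit
(`IsAdmissible.topIndex_map`, `IsAdmissible.tailIndex_map`, `IsAdmissible.moveExp_map`), so the
orbits do form a partition.
-/

/-! ### Counting in modules over the discrete valuation ring -/

section Counting

variable {O : Type*} [CommRing O] [IsDomain O] [IsDiscreteValuationRing O]

theorem finite_quotient_pow_of_isAdic [TopologicalSpace O] [IsTopologicalRing O] [CompactSpace O]
    (hadic : IsAdic (IsLocalRing.maximalIdeal O)) (k : ℕ) :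
    Finite (O ⧸ IsLocalRing.maximalIdeal O ^ k) := by
  have hopen : IsOpen ((IsLocalRing.maximalIdeal O ^ k : Ideal O) : Set O) :=
    (isAdic_iff.mp hadic).1 k
  exact AddSubgroup.quotient_finite_of_isOpen
    (IsLocalRing.maximalIdeal O ^ k).toAddSubgroup hopen

theorem card_residueField_pow_dvd_card {ϖ : O} (hϖ : Irreducible ϖ) {X : Type*} [AddCommGroup X]
    [Module O X] [Finite X] {m : ℕ} {x : X} (hx : m ≠ 0 → ϖ ^ (m - 1) • x ≠ 0) :
    Nat.card (IsLocalRing.ResidueField O) ^ m ∣ Nat.card X := by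
  rcases Nat.eq_zero_or_pos m with rfl | hm
  · simp
  have hx := hx hm.ne'
  have hfield : ¬ IsField O := IsDiscreteValuationRing.not_isField O
  have hinf : Infinite O := by
    by_contra h
    rw [not_infinite_iff_finite] at h
    exact hfield (Finite.isField_of_domain O)
  set I : Ideal O := LinearMap.ker (LinearMap.toSpanSingleton O X x) with hI
  have hI0 : I ≠ ⊥ := by
    intro h
    rw [LinearMap.ker_eq_bot] at h
    exact hinf.not_finite (Finite.of_injective _ h)
  obtain ⟨s, hs⟩ := IsDiscreteValuationRing.ideal_eq_span_pow_irreducible hI0 hϖ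
  have hms : m ≤ s := by
    by_contra! h
    apply hx
    have hmem : ϖ ^ (m - 1) ∈ I := by
      rw [hs, Ideal.mem_span_singleton]
      exact pow_dvd_pow _ (by omega)
    simpa [hI, LinearMap.mem_ker] using hmem
  have hcard : Nat.card (O ⧸ I) = Nat.card (IsLocalRing.ResidueField O) ^ s := by
    have h1 : I = IsLocalRing.maximalIdeal O ^ s := by
      rw [hs, hϖ.maximalIdeal_eq, Ideal.span_singleton_pow]
    have h2 := cardQuot_pow_of_prime (S := O) (P := IsLocalRing.maximalIdeal O)
      (IsDiscreteValuationRing.not_a_field O) (i := s)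
    rw [Submodule.cardQuot_apply, Submodule.cardQuot_apply] at h2
    rw [h1]
    exact h2
  have hrange : Nat.card (O ⧸ I) =
      Nat.card (LinearMap.range (LinearMap.toSpanSingleton O X x)) :=
    Nat.card_congr (LinearMap.quotKerEquivRange _).toEquiv
  calc _ ∣ Nat.card (IsLocalRing.ResidueField O) ^ s := pow_dvd_pow _ hms
    _ = Nat.card (LinearMap.range (LinearMap.toSpanSingleton O X x)) := by rw [← hcard, hrange]
    _ ∣ Nat.card X := AddSubgroup.card_addSubgroup_dvd_card
        (LinearMap.range (LinearMap.toSpanSingleton O X x)).toAddSubgroup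

end Counting

/-! ### Orbits of the groups `1 + J` -/

section Orbits

variable {O : Type*} [CommRing O] {M : Type*} [AddCommGroup M] [Module O M]

/-- A module `J` of endomorphisms for which `1 + J` is a group under composition. -/
structure IsQuasiInvertible (J : Submodule O (Module.End O M)) : Prop where
  mul_mem : ∀ u ∈ J, ∀ v ∈ J, u * v ∈ J
  exists_inv : ∀ u ∈ J, ∃ v ∈ J, (1 + u) * (1 + v) = 1

/-- The orbit of the submodule `Λ` under the set `1 + J` of endomorphisms. -/
def unipotentOrbit (J : Submodule O (Module.End O M)) (Λ : Submodule O M) :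
    Set (Submodule O M) :=
  {Λ' | ∃ u ∈ J, Λ' = Λ.map (1 + u)}

namespace IsQuasiInvertible

variable {J : Submodule O (Module.End O M)}

theorem exists_two_sided_inv (hJ : IsQuasiInvertible J) {u : Module.End O M} (hu : u ∈ J) :
    ∃ v ∈ J, (1 + u) * (1 + v) = 1 ∧ (1 + v) * (1 + u) = 1 := by
  obtain ⟨v, hv, huv⟩ := hJ.exists_inv u hu
  obtain ⟨z, hz, hvz⟩ := hJ.exists_inv v hv
  have : 1 + u = 1 + z := left_inv_eq_right_inv huv hvz
  exact ⟨v, hv, huv, by rw [this]; exact hvz⟩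

theorem one_add_mul_sub_one_mem (hJ : IsQuasiInvertible J) {u v : Module.End O M}
    (hu : u ∈ J) (hv : v ∈ J) :
    (1 + u) * (1 + v) - 1 ∈ J := by
  have : (1 + u) * (1 + v) - 1 = u + v + u * v := by noncomm_ring
  rw [this]
  exact J.add_mem (J.add_mem hu hv) (hJ.mul_mem u hu v hv)

theorem unipotentOrbit_eq (hJ : IsQuasiInvertible J) {Λ Λ' : Submodule O M}
    (h : Λ' ∈ unipotentOrbit J Λ) :
    unipotentOrbit J Λ' = unipotentOrbit J Λ := by
  obtain ⟨u, hu, rfl⟩ := h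
  obtain ⟨u', hu', h1, h2⟩ := hJ.exists_two_sided_inv hu
  ext Γ
  constructor
  · rintro ⟨v, hv, rfl⟩
    refine ⟨(1 + v) * (1 + u) - 1, hJ.one_add_mul_sub_one_mem hv hu, ?_⟩
    rw [← Submodule.map_comp, add_sub_cancel]
    rfl
  · rintro ⟨v, hv, rfl⟩
    refine ⟨(1 + v) * (1 + u') - 1, hJ.one_add_mul_sub_one_mem hv hu', ?_⟩
    rw [← Submodule.map_comp, add_sub_cancel]
    congr 1
    change 1 + v = (1 + v) * (1 + u') * (1 + u)
    rw [mul_assoc, h2, mul_one]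

end IsQuasiInvertible

theorem self_mem_unipotentOrbit (J : Submodule O (Module.End O M)) (Λ : Submodule O M) :
    Λ ∈ unipotentOrbit J Λ :=
  ⟨0, J.zero_mem, by rw [add_zero]; exact (Submodule.map_id Λ).symm⟩

/-- The elements of `J` that map `Λ` into itself. -/
def stabilizing (J : Submodule O (Module.End O M)) (Λ : Submodule O M) : Submodule O J where
  carrier := {u | ∀ x ∈ Λ, (u : Module.End O M) x ∈ Λ}
  add_mem' := fun ha hb x hx => Λ.add_mem (ha x hx) (hb x hx)
  zero_mem' := fun _ _ => Λ.zero_mem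
  smul_mem' := fun c _ ha x hx => Λ.smul_mem c (ha x hx)


namespace IsQuasiInvertible

variable {J : Submodule O (Module.End O M)}

theorem injective_one_add (hJ : IsQuasiInvertible J) {u : Module.End O M} (hu : u ∈ J) :
    Function.Injective (1 + u : Module.End O M) := by
  obtain ⟨v, -, -, h⟩ := hJ.exists_two_sided_inv hu
  exact Function.LeftInverse.injective (g := (1 + v : Module.End O M)) fun x => by
    rw [← Module.End.mul_apply, h, Module.End.one_apply]

theorem map_eq_self_of_mem_stabilizing [Finite M] (hJ : IsQuasiInvertible J) {Λ : Submodule O M}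
    {n : J} (hn : n ∈ stabilizing J Λ) : Λ.map (1 + (n : Module.End O M)) = Λ := by
  have hmaps : ∀ x ∈ Λ, (1 + (n : Module.End O M)) x ∈ Λ := fun x hx =>
    Λ.add_mem hx (hn x hx)
  apply le_antisymm
  · rintro _ ⟨x, hx, rfl⟩
    exact hmaps x hx
  · intro y hy
    have hinj : Function.Injective ((1 + (n : Module.End O M)).restrict hmaps) := by
      intro a b hab
      exact Subtype.ext (hJ.injective_one_add n.2 (congrArg Subtype.val hab))
    obtain ⟨x, hx⟩ := Finite.surjective_of_injective hinj ⟨y, hy⟩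
    exact ⟨x, x.2, congrArg Subtype.val hx⟩

/-- The elements of `J` that carry `Λ` to a given member of its orbit correspond to the elements
that stabilize `Λ`, through `1 + u = (1 + u₀) (1 + n)`. -/
theorem card_fiber [Finite M] (hJ : IsQuasiInvertible J) (Λ : Submodule O M) (u₀ : J) :
    Nat.card {u : J // Λ.map (1 + (u : Module.End O M)) = Λ.map (1 + (u₀ : Module.End O M))} =
      Nat.card (stabilizing J Λ) := by
  symm
  obtain ⟨v₀, hv₀, h1, h2⟩ := hJ.exists_two_sided_inv u₀.2
  let f : stabilizing J Λ →
      {u : J // Λ.map (1 + (u : Module.End O M)) = Λ.map (1 + (u₀ : Module.End O M))} := fun n =>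
    ⟨⟨(1 + (u₀ : Module.End O M)) * (1 + ((n : J) : Module.End O M)) - 1,
      hJ.one_add_mul_sub_one_mem u₀.2 (n : J).2⟩, by
      change Λ.map (1 + ((1 + (u₀ : Module.End O M)) * (1 + ((n : J) : Module.End O M)) - 1)) = _
      rw [add_sub_cancel, Module.End.mul_eq_comp, Submodule.map_comp,
        hJ.map_eq_self_of_mem_stabilizing n.2]⟩
  refine Nat.card_eq_of_bijective f ⟨?_, ?_⟩
  · intro a b hab
    have h : (1 + (u₀ : Module.End O M)) * (1 + ((a : J) : Module.End O M)) - 1 =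
        (1 + (u₀ : Module.End O M)) * (1 + ((b : J) : Module.End O M)) - 1 :=
      congrArg Subtype.val (congrArg Subtype.val hab)
    have h' := congrArg (fun z => (1 + v₀) * (z + 1)) h
    simp only [sub_add_cancel, ← mul_assoc, h2, one_mul] at h'
    exact Subtype.ext (Subtype.ext (add_left_cancel h'))
  · rintro ⟨u, hu⟩
    refine ⟨⟨⟨(1 + v₀) * (1 + (u : Module.End O M)) - 1,
      hJ.one_add_mul_sub_one_mem hv₀ u.2⟩, ?_⟩, ?_⟩
    · intro x hx
      have hmem : (1 + (u : Module.End O M)) x ∈ Λ.map (1 + (u₀ : Module.End O M)) :=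
        hu ▸ Submodule.mem_map_of_mem hx
      obtain ⟨y, hy, hyx⟩ := hmem
      change ((1 + v₀) * (1 + (u : Module.End O M))) x - x ∈ Λ
      rw [Module.End.mul_apply, ← hyx, ← Module.End.mul_apply, h2]
      exact Λ.sub_mem hy hx
    · apply Subtype.ext
      apply Subtype.ext
      change (1 + (u₀ : Module.End O M)) * (1 + ((1 + v₀) * (1 + (u : Module.End O M)) - 1)) - 1
        = u
      rw [add_sub_cancel, ← mul_assoc, h1, one_mul, add_sub_cancel_left]

theorem ncard_unipotentOrbit [Finite M] (hJ : IsQuasiInvertible J) (Λ : Submodule O M) :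
    (unipotentOrbit J Λ).ncard = Nat.card (J ⧸ stabilizing J Λ) := by
  have : Finite (Module.End O M) := DFunLike.finite _
  let f : J → Submodule O M := fun u => Λ.map (1 + (u : Module.End O M))
  have hrange : unipotentOrbit J Λ = Set.range f := by
    ext Γ
    constructor
    · rintro ⟨u, hu, rfl⟩
      exact ⟨⟨u, hu⟩, rfl⟩
    · rintro ⟨u, rfl⟩
      exact ⟨u, u.2, rfl⟩
  have hcount : Nat.card J = Nat.card (Set.range f) * Nat.card (stabilizing J Λ) := by
    have : Fintype (Set.range f) := Fintype.ofFinite _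
    rw [← Nat.card_congr (Equiv.sigmaFiberEquiv (Set.rangeFactorization f)), Nat.card_sigma,
      Finset.sum_const_nat (m := Nat.card (stabilizing J Λ)), Finset.card_univ,
      Nat.card_eq_fintype_card (α := Set.range f)]
    rintro ⟨_, u₀, rfl⟩ -
    rw [← hJ.card_fiber Λ u₀]
    refine Nat.card_congr (Equiv.subtypeEquivRight fun u => ?_)
    rw [Subtype.ext_iff]
    rfl
  have hquot := Submodule.card_eq_card_quotient_mul_card (stabilizing J Λ)
  have hpos : 0 < Nat.card (stabilizing J Λ) := Nat.card_pos
  rw [hrange]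
  refine Nat.eq_of_mul_eq_mul_right hpos ?_
  rw [← Nat.card_coe_set_eq, ← hcount, hquot, mul_comm]

theorem card_residueField_pow_dvd_of_finite [IsDomain O] [IsDiscreteValuationRing O] [Finite M]
    {ϖ : O} (hϖ : Irreducible ϖ) (hJ : IsQuasiInvertible J) {Λ : Submodule O M} {m : ℕ}
    {u : Module.End O M} (hu : u ∈ J) {x : M} (hx : x ∈ Λ)
    (hux : m ≠ 0 → ϖ ^ (m - 1) • u x ∉ Λ) :
    Nat.card (IsLocalRing.ResidueField O) ^ m ∣ (unipotentOrbit J Λ).ncard := by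
  rw [hJ.ncard_unipotentOrbit]
  have : Finite (Module.End O M) := DFunLike.finite _
  have : Finite (J ⧸ stabilizing J Λ) := Finite.of_surjective _ (Submodule.mkQ_surjective _)
  refine card_residueField_pow_dvd_card hϖ
    (x := Submodule.mkQ (stabilizing J Λ) ⟨u, hu⟩) fun hm h => hux hm ?_
  rw [← map_smul, Submodule.mkQ_apply, Submodule.Quotient.mk_eq_zero] at h
  exact h x hx

/-- The endomorphism of `M ⧸ P` induced by an endomorphism of `M`, when `P` is stable under all
endomorphisms. -/
def endQuotient (P : Submodule O M) (hP : ∀ u : Module.End O M, P ≤ P.comap u) :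
    Module.End O M →ₗ[O] Module.End O (M ⧸ P) where
  toFun u := P.mapQ P u (hP u)
  map_add' _ _ := Submodule.linearMap_qext _ rfl
  map_smul' _ _ := Submodule.linearMap_qext _ rfl

theorem endQuotient_mul (P : Submodule O M) (hP : ∀ u : Module.End O M, P ≤ P.comap u)
    (u v : Module.End O M) : endQuotient P hP (u * v) = endQuotient P hP u * endQuotient P hP v :=
  Submodule.linearMap_qext _ rfl

theorem endQuotient_one (P : Submodule O M) (hP : ∀ u : Module.End O M, P ≤ P.comap u) :
    endQuotient P hP 1 = 1 :=
  Submodule.linearMap_qext _ rfl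

theorem map_endQuotient (hJ : IsQuasiInvertible J) (P : Submodule O M)
    (hP : ∀ u : Module.End O M, P ≤ P.comap u) :
    IsQuasiInvertible (J.map (endQuotient P hP)) where
  mul_mem := by
    rintro _ ⟨u, hu, rfl⟩ _ ⟨v, hv, rfl⟩
    exact ⟨u * v, hJ.mul_mem u hu v hv, endQuotient_mul P hP u v⟩
  exists_inv := by
    rintro _ ⟨u, hu, rfl⟩
    obtain ⟨v, hv, h⟩ := hJ.exists_inv u hu
    refine ⟨_, ⟨v, hv, rfl⟩, ?_⟩
    rw [← endQuotient_one P hP, ← map_add, ← map_add, ← endQuotient_mul, h]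

/-- The orbit of `Λ` under `1 + J` has as many elements as `J ⧸ (J ∩ End Λ)`, which is a finite
module over `O`. The count is made modulo `P`, where everything is finite. -/
theorem card_residueField_pow_dvd_ncard_unipotentOrbit [IsDomain O] [IsDiscreteValuationRing O]
    {ϖ : O} (hϖ : Irreducible ϖ) (hJ : IsQuasiInvertible J) (P : Submodule O M) [Finite (M ⧸ P)]
    (hP : ∀ u : Module.End O M, P ≤ P.comap u) {Λ : Submodule O M} (hPΛ : P ≤ Λ) {m : ℕ}
    {u : Module.End O M} (hu : u ∈ J) {x : M} (hx : x ∈ Λ)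
    (hux : m ≠ 0 → ϖ ^ (m - 1) • u x ∉ Λ) :
    Nat.card (IsLocalRing.ResidueField O) ^ m ∣ (unipotentOrbit J Λ).ncard := by
  have hP' : ∀ Γ ∈ unipotentOrbit J Λ, P ≤ Γ := by
    rintro _ ⟨v, hv, rfl⟩ p hp
    obtain ⟨z, -, h1, -⟩ := hJ.exists_two_sided_inv hv
    refine ⟨(1 + z) p, hPΛ (P.add_mem hp (hP z hp)), ?_⟩
    rw [← Module.End.mul_apply, h1, Module.End.one_apply]
  have himage : unipotentOrbit (J.map (endQuotient P hP)) (Λ.map P.mkQ) =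
      (fun Γ => Submodule.map P.mkQ Γ) '' unipotentOrbit J Λ := by
    have hcomm : ∀ v : Module.End O M, (Λ.map P.mkQ).map (1 + endQuotient P hP v) =
        (Λ.map (1 + v)).map P.mkQ := by
      intro v
      rw [← Submodule.map_comp, ← Submodule.map_comp]
      rfl
    ext Γ
    constructor
    · rintro ⟨_, ⟨v, hv, rfl⟩, rfl⟩
      exact ⟨_, ⟨v, hv, rfl⟩, (hcomm v).symm⟩
    · rintro ⟨_, ⟨v, hv, rfl⟩, rfl⟩
      exact ⟨_, ⟨v, hv, rfl⟩, (hcomm v).symm⟩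
  have hinj : Set.InjOn (fun Γ => Submodule.map P.mkQ Γ) (unipotentOrbit J Λ) := by
    intro Γ hΓ Γ' hΓ' h
    have h' := congrArg (Submodule.comap P.mkQ) h
    simpa only [Submodule.comap_map_mkQ, sup_eq_right.mpr (hP' Γ hΓ),
      sup_eq_right.mpr (hP' Γ' hΓ')] using h'
  rw [← hinj.ncard_image, ← himage]
  refine (hJ.map_endQuotient P hP).card_residueField_pow_dvd_of_finite hϖ
    (u := endQuotient P hP u) ⟨u, hu, rfl⟩ (Submodule.mem_map_of_mem hx) fun hm h => hux hm ?_
  have h1 : P.mkQ (ϖ ^ (m - 1) • u x) ∈ Λ.map P.mkQ := h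
  have h2 : ϖ ^ (m - 1) • u x ∈ (Λ.map P.mkQ).comap P.mkQ := h1
  rwa [Submodule.comap_map_mkQ, sup_eq_right.mpr hPΛ] at h2

end IsQuasiInvertible
end Orbits

/-- If a finite set is partitioned into classes whose sizes are multiples of `d`, then so is its
own size. -/
theorem dvd_ncard_of_classes {α : Type*} {X : Set α} (hX : X.Finite) {d : ℕ} (cls : α → Set α)
    (hself : ∀ x ∈ X, x ∈ cls x) (hsub : ∀ x ∈ X, cls x ⊆ X)
    (heq : ∀ x ∈ X, ∀ y ∈ cls x, cls y = cls x) (hd : ∀ x ∈ X, d ∣ (cls x).ncard) :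
    d ∣ X.ncard := by
  classical
  rw [Set.ncard_eq_toFinset_card X hX, Finset.card_eq_sum_card_image cls]
  refine Finset.dvd_sum fun c hc => ?_
  obtain ⟨x, hx, rfl⟩ := Finset.mem_image.mp hc
  rw [Set.Finite.mem_toFinset] at hx
  have hd := hd x hx
  rw [← Set.ncard_coe_finset]
  refine hd.trans (dvd_of_eq (congrArg Set.ncard ?_))
  ext y
  rw [Finset.mem_coe, Finset.mem_filter, Set.Finite.mem_toFinset]
  exact ⟨fun h => ⟨hsub x hx h, heq x hx y h⟩, fun h => h.2 ▸ hself y h.1⟩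

/-! ### Flags, and the exponents of a lattice relative to a flag -/

section Flag

variable {O : Type*} [CommRing O] {M : Type*} [AddCommGroup M] [Module O M] {n : ℕ}

/-- The `k`-th member of the flag of a basis `e`: the span of the basis vectors with index at
least `k` (indices start at `0`). -/
def tailFlag (e : Module.Basis (Fin n) O M) (k : ℕ) : Submodule O M where
  carrier := {x | ∀ l : Fin n, (l : ℕ) < k → e.repr x l = 0}
  add_mem' := fun ha hb l hl => by simp [ha l hl, hb l hl]
  zero_mem' := fun _ _ => by simp
  smul_mem' := fun c _ ha l hl => by simp [ha l hl]

/-- Multiplication by any element, on either side, moves the flag of `e` one step down. -/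
def ShiftsFlag (mul : M →ₗ[O] M →ₗ[O] M) (e : Module.Basis (Fin n) O M) : Prop :=
  ∀ k x, ∀ y ∈ tailFlag e k, mul x y ∈ tailFlag e (k + 1) ∧ mul y x ∈ tailFlag e (k + 1)

/-- The largest `t` such that `ϖ ^ t` divides the coordinates with index less than `k` of all
elements of `Λ`; the value for `k = 0`, where there is no largest `t`, is `0`. -/
noncomputable def topExp (ϖ : O) (e : Module.Basis (Fin n) O M) (Λ : Submodule O M) (k : ℕ) : ℕ :=
  sInf {t | ¬ ∀ x ∈ Λ, ∀ l : Fin n, (l : ℕ) < k → ϖ ^ (t + 1) ∣ e.repr x l}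

/-- The least `t` such that `Λ` contains `ϖ ^ t` times the `k`-th member of the flag of `e`. -/
noncomputable def tailExp (ϖ : O) (e : Module.Basis (Fin n) O M) (Λ : Submodule O M) (k : ℕ) : ℕ :=
  sInf {t | ∀ x ∈ tailFlag e k, ϖ ^ t • x ∈ Λ}

variable {e : Module.Basis (Fin n) O M} {Λ : Submodule O M} {ϖ : O}

theorem tailFlag_anti {k l : ℕ} (h : k ≤ l) : tailFlag e l ≤ tailFlag e k :=
  fun _ hx i hi => hx i (hi.trans_le h)

theorem mem_tailFlag_zero (x : M) : x ∈ tailFlag e 0 := fun _ h => absurd h (Nat.not_lt_zero _)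

theorem eq_zero_of_mem_tailFlag {k : ℕ} (hk : n ≤ k) {x : M} (hx : x ∈ tailFlag e k) : x = 0 := by
  apply e.repr.injective
  ext l
  rw [map_zero, hx l (l.2.trans_le hk)]
  rfl

theorem exists_add_smul_of_dvd {d : O} {k : ℕ} {x : M}
    (h : ∀ l : Fin n, (l : ℕ) < k → d ∣ e.repr x l) :
    ∃ f ∈ tailFlag e k, ∃ y, x = f + d • y := by
  classical
  choose! c hc using h
  set y : M := e.equivFun.symm fun l => if (l : ℕ) < k then c l else 0 with hy
  refine ⟨x - d • y, fun l hl => ?_, y, by abel⟩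
  have h1 : e.repr y l = c l := by
    rw [← Module.Basis.equivFun_apply, hy, LinearEquiv.apply_symm_apply, if_pos hl]
  simp [h1, hc l hl]

theorem topExp_spec {k : ℕ} {x : M} (hx : x ∈ Λ) {l : Fin n} (hl : (l : ℕ) < k) :
    ϖ ^ topExp ϖ e Λ k ∣ e.repr x l := by
  rcases Nat.eq_zero_or_pos (topExp ϖ e Λ k) with h | h
  · rw [h, pow_zero]
    exact one_dvd _
  · have hlt : topExp ϖ e Λ k - 1 < topExp ϖ e Λ k := by omega
    have h1 := Nat.notMem_of_lt_sInf hlt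
    simp only [Set.mem_ofPred_eq, not_not] at h1
    have h2 := h1 x hx l hl
    rwa [Nat.sub_add_cancel h] at h2

theorem exists_add_pow_topExp_smul (k : ℕ) {x : M} (hx : x ∈ Λ) :
    ∃ f ∈ tailFlag e k, ∃ y, x = f + ϖ ^ topExp ϖ e Λ k • y :=
  exists_add_smul_of_dvd fun _ hl => topExp_spec hx hl

theorem tailExp_le {k t : ℕ} (h : ∀ x ∈ tailFlag e k, ϖ ^ t • x ∈ Λ) : tailExp ϖ e Λ k ≤ t :=
  Nat.sInf_le h

/-- `Λ` contains `ϖ ^ N` times the whole module for some `N`. -/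
def IsOpenLattice (ϖ : O) (Λ : Submodule O M) : Prop := ∃ N : ℕ, ∀ x : M, ϖ ^ N • x ∈ Λ

theorem pow_smul_mem_of_tailExp_le (hΛ : IsOpenLattice ϖ Λ) {k t : ℕ}
    (h : tailExp ϖ e Λ k ≤ t) {x : M} (hx : x ∈ tailFlag e k) : ϖ ^ t • x ∈ Λ := by
  obtain ⟨N, hN⟩ := hΛ
  have hne : {t | ∀ x ∈ tailFlag e k, ϖ ^ t • x ∈ Λ}.Nonempty := ⟨N, fun x _ => hN x⟩
  have h1 : ϖ ^ tailExp ϖ e Λ k • x ∈ Λ := Nat.sInf_mem hne x hx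
  rw [← Nat.sub_add_cancel h, pow_add, mul_smul]
  exact Λ.smul_mem _ h1

theorem tailExp_anti (hΛ : IsOpenLattice ϖ Λ) {k l : ℕ} (h : k ≤ l) :
    tailExp ϖ e Λ l ≤ tailExp ϖ e Λ k :=
  tailExp_le fun _ hx => pow_smul_mem_of_tailExp_le hΛ le_rfl (tailFlag_anti h hx)

variable [IsDomain O]

theorem exists_not_pow_dvd_repr (hϖ : Irreducible ϖ) (hΛ : IsOpenLattice ϖ Λ) (hn : 0 < n) {k : ℕ}
    (hk : 0 < k) : ∃ x ∈ Λ, ∃ l : Fin n, (l : ℕ) < k ∧ ¬ ϖ ^ (topExp ϖ e Λ k + 1) ∣ e.repr x l := by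
  obtain ⟨N, hN⟩ := hΛ
  have hne : {t | ¬ ∀ x ∈ Λ, ∀ l : Fin n, (l : ℕ) < k → ϖ ^ (t + 1) ∣ e.repr x l}.Nonempty := by
    refine ⟨N, fun h => ?_⟩
    have h1 := h _ (hN (e ⟨0, hn⟩)) ⟨0, hn⟩ hk
    simp only [map_smul, Module.Basis.repr_self, Finsupp.smul_apply, Finsupp.single_eq_same,
      smul_eq_mul, mul_one] at h1
    rw [pow_succ, mul_comm] at h1
    exact hϖ.not_isUnit (isUnit_of_dvd_one
      ((mul_dvd_mul_iff_right (pow_ne_zero N hϖ.ne_zero)).mp (by rwa [one_mul])))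
  have h1 : ¬ ∀ x ∈ Λ, ∀ l : Fin n, (l : ℕ) < k → ϖ ^ (topExp ϖ e Λ k + 1) ∣ e.repr x l :=
    Nat.sInf_mem hne
  push Not at h1
  exact h1

theorem le_topExp (hϖ : Irreducible ϖ) (hΛ : IsOpenLattice ϖ Λ) (hn : 0 < n) {k : ℕ}
    (hk : 0 < k) {t : ℕ} (h : ∀ x ∈ Λ, ∀ l : Fin n, (l : ℕ) < k → ϖ ^ t ∣ e.repr x l) :
    t ≤ topExp ϖ e Λ k := by
  by_contra! hlt
  obtain ⟨x, hx, l, hl, hd⟩ := exists_not_pow_dvd_repr (e := e) hϖ hΛ hn hk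
  exact hd ((pow_dvd_pow ϖ hlt).trans (h x hx l hl))

theorem topExp_anti (hϖ : Irreducible ϖ) (hΛ : IsOpenLattice ϖ Λ) (hn : 0 < n) {k l : ℕ}
    (hk : 0 < k) (h : k ≤ l) : topExp ϖ e Λ l ≤ topExp ϖ e Λ k :=
  le_topExp hϖ hΛ hn hk fun _ hx _ hi => topExp_spec hx (hi.trans_le h)

/-- Some coordinate with index less than `k` of some element of `Λ` is exactly divisible by
`ϖ ^ topExp ϖ e Λ k`. -/
theorem exists_repr_eq_pow_topExp_mul_unit [IsDiscreteValuationRing O] (hϖ : Irreducible ϖ)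
    (hΛ : IsOpenLattice ϖ Λ) (hn : 0 < n) {k : ℕ} (hk : 0 < k) :
    ∃ x ∈ Λ, ∃ l : Fin n, (l : ℕ) < k ∧ ∃ c : Oˣ, e.repr x l = ϖ ^ topExp ϖ e Λ k * c := by
  obtain ⟨x, hx, l, hl, hxl⟩ := exists_not_pow_dvd_repr (e := e) hϖ hΛ hn hk
  obtain ⟨c, hc⟩ := topExp_spec (ϖ := ϖ) hx hl
  have hcu : IsUnit c := by
    by_contra hcu
    rw [← mem_nonunits_iff, ← IsLocalRing.mem_maximalIdeal, hϖ.maximalIdeal_eq,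
      Ideal.mem_span_singleton] at hcu
    obtain ⟨d, rfl⟩ := hcu
    exact hxl ⟨d, by rw [hc, pow_succ, mul_assoc]⟩
  obtain ⟨c, rfl⟩ := hcu
  exact ⟨x, hx, l, hl, c, hc⟩

end Flag

/-! ### Moves along a flag -/

section Moves

variable {O : Type*} [CommRing O] {M : Type*} [AddCommGroup M] [Module O M] {n : ℕ}

/-- The endomorphisms that vanish on the `i`-th member of the flag of `e` and map into `ϖ ^ a`
times its `j`-th member. -/
def flagMoves (ϖ : O) (e : Module.Basis (Fin n) O M) (i j a : ℕ) :
    Submodule O (Module.End O M) where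
  carrier := {u | (∀ x ∈ tailFlag e i, u x = 0) ∧ ∀ x, ∃ y ∈ tailFlag e j, u x = ϖ ^ a • y}
  add_mem' := by
    rintro u v ⟨hu, hu'⟩ ⟨hv, hv'⟩
    refine ⟨fun x hx => by simp [hu x hx, hv x hx], fun x => ?_⟩
    obtain ⟨y, hy, h⟩ := hu' x
    obtain ⟨z, hz, h'⟩ := hv' x
    exact ⟨y + z, add_mem hy hz, by simp [h, h']⟩
  zero_mem' := ⟨fun _ _ => rfl, fun _ => ⟨0, zero_mem _, by simp⟩⟩
  smul_mem' := by
    rintro c u ⟨hu, hu'⟩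
    refine ⟨fun x hx => by simp [hu x hx], fun x => ?_⟩
    obtain ⟨y, hy, h⟩ := hu' x
    exact ⟨c • y, Submodule.smul_mem _ c hy, by simp [h, smul_comm c]⟩

variable {e : Module.Basis (Fin n) O M} {ϖ : O} {i j a : ℕ}

/-- An endomorphism congruent to the identity modulo `ϖ` is surjective by Nakayama's lemma, hence
bijective. -/
theorem isUnit_one_add_of_smul [IsLocalRing O] [Module.Finite O M] (hϖ : ¬ IsUnit ϖ)
    {u : Module.End O M} (hu : ∀ x, ∃ y, u x = ϖ • y) : IsUnit (1 + u) := by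
  have hsurj : Function.Surjective (1 + u : Module.End O M) := by
    rw [← LinearMap.range_eq_top, eq_top_iff]
    apply Submodule.le_of_le_smul_of_le_jacobson_bot (I := IsLocalRing.maximalIdeal O)
      Module.Finite.fg_top
      (IsLocalRing.maximalIdeal_le_jacobson _)
    intro x _
    obtain ⟨y, hy⟩ := hu x
    have hx : x = (1 + u) x - ϖ • y := by
      rw [← hy]
      simp
    rw [hx]
    exact Submodule.sub_mem_sup (LinearMap.mem_range_self _ x)
      (Submodule.smul_mem_smul ((IsLocalRing.mem_maximalIdeal ϖ).mpr hϖ) Submodule.mem_top)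
  have hbij : Function.Bijective (1 + u : Module.End O M) :=
    ⟨OrzechProperty.injective_of_surjective_endomorphism _ hsurj, hsurj⟩
  exact (Module.End.isUnit_iff _).mpr hbij

/-- `1 + flagMoves` is a group when the moves either have square zero or are divisible by `ϖ`. -/
theorem isQuasiInvertible_flagMoves [IsLocalRing O] [Module.Finite O M] (hϖ : ¬ IsUnit ϖ)
    (h : i ≤ j ∨ a ≠ 0) : IsQuasiInvertible (flagMoves ϖ e i j a) where
  mul_mem := by
    rintro u ⟨hu, hu'⟩ v ⟨hv, hv'⟩
    exact ⟨fun x hx => by rw [Module.End.mul_apply, hv x hx, map_zero], fun x => hu' (v x)⟩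
  exists_inv := by
    intro u hu
    rcases h with hij | ha
    · refine ⟨-u, neg_mem hu, ?_⟩
      have huu : u * u = 0 := by
        ext x
        obtain ⟨y, hy, hxy⟩ := hu.2 x
        rw [Module.End.mul_apply, hxy, map_smul, hu.1 y (tailFlag_anti hij hy), smul_zero]
        rfl
      have : (1 + u) * (1 + -u) = 1 - u * u := by noncomm_ring
      rw [this, huu, sub_zero]
    · have hunit : IsUnit (1 + u) := isUnit_one_add_of_smul hϖ fun x => by
        obtain ⟨y, -, hxy⟩ := hu.2 x
        refine ⟨ϖ ^ (a - 1) • y, ?_⟩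
        rw [hxy, ← mul_smul, ← pow_succ', Nat.sub_add_cancel (Nat.pos_of_ne_zero ha)]
      obtain ⟨⟨g, g', hgg', hg'g⟩, rfl : g = 1 + u⟩ := hunit
      -- `g' - 1` is both `-g' u`, which vanishes where `u` does, and `-u g'`, which maps into the
      -- image of `u`.
      refine ⟨g' - 1, ⟨fun x hx => ?_, fun x => ?_⟩, by rw [add_sub_cancel]; exact hgg'⟩
      · have h1 : (g' * (1 + u)) x = g' x := by
          rw [Module.End.mul_apply, LinearMap.add_apply, hu.1 x hx, add_zero, Module.End.one_apply]
        rw [LinearMap.sub_apply, ← h1, hg'g, sub_self]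
      · obtain ⟨y, hy, hxy⟩ := hu.2 (g' x)
        refine ⟨-y, neg_mem hy, ?_⟩
        have h1 : g' x + u (g' x) = x := by
          have := LinearMap.congr_fun hgg' x
          simpa using this
        rw [smul_neg, ← hxy, LinearMap.sub_apply, Module.End.one_apply]
        nth_rewrite 2 [← h1]
        abel

section Map

variable {Λ : Submodule O M} {u : Module.End O M}

/-- On `Λ`, moves gain the divisibility that elements of `Λ` have above the `i`-th member of the
flag. -/
theorem apply_eq_pow_smul_of_mem (hu : u ∈ flagMoves ϖ e i j a) {x : M} (hx : x ∈ Λ) :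
    ∃ y ∈ tailFlag e j, u x = ϖ ^ (a + topExp ϖ e Λ i) • y := by
  obtain ⟨f, hf, z, hz⟩ := exists_add_pow_topExp_smul (ϖ := ϖ) (e := e) i hx
  obtain ⟨y, hy, hzy⟩ := hu.2 z
  refine ⟨y, hy, ?_⟩
  rw [hz, map_add, hu.1 f hf, zero_add, map_smul, hzy, ← mul_smul, ← pow_add, add_comm]


theorem IsOpenLattice.map_one_add (hJ : IsQuasiInvertible (flagMoves ϖ e i j a))
    (hΛ : IsOpenLattice ϖ Λ) (hu : u ∈ flagMoves ϖ e i j a) :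
    IsOpenLattice ϖ (Λ.map (1 + u)) := by
  obtain ⟨v, -, h⟩ := hJ.exists_inv u hu
  obtain ⟨N, hN⟩ := hΛ
  refine ⟨N, fun x => ⟨(1 + v) (ϖ ^ N • x), by rw [map_smul]; exact hN _, ?_⟩⟩
  rw [← Module.End.mul_apply, h, Module.End.one_apply]

/-- Moving `Λ` does not raise the exponent of a member of the flag above a bound `t`, if the moves
fix that member or shift `ϖ ^ t` times it into the part of `Λ` in the `j`-th member. -/
theorem tailExp_map_le (hJ : IsQuasiInvertible (flagMoves ϖ e i j a)) (hΛ : IsOpenLattice ϖ Λ)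
    (hu : u ∈ flagMoves ϖ e i j a) {k t : ℕ} (hk : tailExp ϖ e Λ k ≤ t)
    (h : i ≤ k ∨ tailExp ϖ e Λ j ≤ a + t) : tailExp ϖ e (Λ.map (1 + u)) k ≤ t := by
  obtain ⟨v, hv, hvu⟩ := hJ.exists_inv u hu
  refine tailExp_le fun x hx => ⟨(1 + v) (ϖ ^ t • x), ?_, ?_⟩
  · rw [LinearMap.add_apply, Module.End.one_apply]
    refine add_mem (pow_smul_mem_of_tailExp_le hΛ hk hx) ?_
    rw [map_smul]
    rcases h with h | h
    · rw [hv.1 x (tailFlag_anti h hx), smul_zero]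
      exact Λ.zero_mem
    · obtain ⟨y, hy, hxy⟩ := hv.2 x
      rw [hxy, ← mul_smul, ← pow_add, add_comm]
      exact pow_smul_mem_of_tailExp_le hΛ h hy
  · rw [← Module.End.mul_apply, hvu, Module.End.one_apply]

theorem exists_inv_map (hJ : IsQuasiInvertible (flagMoves ϖ e i j a))
    (hu : u ∈ flagMoves ϖ e i j a) :
    ∃ v ∈ flagMoves ϖ e i j a, (Λ.map (1 + u)).map (1 + v) = Λ := by
  obtain ⟨v, hv, -, hvu⟩ := hJ.exists_two_sided_inv hu
  refine ⟨v, hv, ?_⟩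
  rw [← Submodule.map_comp, ← Module.End.mul_eq_comp, hvu]
  exact Submodule.map_id Λ

theorem tailExp_map_eq (hJ : IsQuasiInvertible (flagMoves ϖ e i j a)) (hΛ : IsOpenLattice ϖ Λ)
    (hu : u ∈ flagMoves ϖ e i j a) {k : ℕ} (h : i ≤ k ∨ k ≤ j) :
    tailExp ϖ e (Λ.map (1 + u)) k = tailExp ϖ e Λ k := by
  have key : ∀ {Γ : Submodule O M}, IsOpenLattice ϖ Γ → ∀ {v}, v ∈ flagMoves ϖ e i j a →
      tailExp ϖ e (Γ.map (1 + v)) k ≤ tailExp ϖ e Γ k := fun hΓ _ hv =>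
    tailExp_map_le hJ hΓ hv le_rfl
      (h.imp_right fun h => (tailExp_anti hΓ h).trans (Nat.le_add_left _ _))
  obtain ⟨v, hv, hvu⟩ := exists_inv_map (Λ := Λ) hJ hu
  refine le_antisymm (key hΛ hu) ?_
  have := key (hΛ.map_one_add hJ hu) hv
  rwa [hvu] at this

variable [IsDomain O]

/-- Moving `Λ` does not lower the divisibility of the first `k` coordinates below a bound `t`, if
the moves do not affect these coordinates or change them by multiples of `ϖ ^ t`. -/
theorem le_topExp_map (hϖ : Irreducible ϖ) (hn : 0 < n)
    (hJ : IsQuasiInvertible (flagMoves ϖ e i j a)) (hΛ : IsOpenLattice ϖ Λ)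
    (hu : u ∈ flagMoves ϖ e i j a) {k t : ℕ} (hk : 0 < k) (ht : t ≤ topExp ϖ e Λ k)
    (h : k ≤ j ∨ t ≤ a + topExp ϖ e Λ i) : t ≤ topExp ϖ e (Λ.map (1 + u)) k := by
  refine le_topExp hϖ (hΛ.map_one_add hJ hu) hn hk ?_
  rintro _ ⟨x, hx, rfl⟩ l hl
  rw [LinearMap.add_apply, Module.End.one_apply, map_add, Finsupp.add_apply]
  refine dvd_add ((pow_dvd_pow ϖ ht).trans (topExp_spec hx hl)) ?_
  obtain ⟨y, hy, hxy⟩ := apply_eq_pow_smul_of_mem hu hx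
  rw [hxy, map_smul, Finsupp.smul_apply, smul_eq_mul]
  rcases h with h | h
  · rw [hy l (hl.trans_le h), mul_zero]
    exact dvd_zero _
  · exact (pow_dvd_pow ϖ h).mul_right _

theorem topExp_map_eq (hϖ : Irreducible ϖ) (hn : 0 < n)
    (hJ : IsQuasiInvertible (flagMoves ϖ e i j a)) (hΛ : IsOpenLattice ϖ Λ)
    (hu : u ∈ flagMoves ϖ e i j a) {k : ℕ} (hi : 0 < i) (hk : 0 < k) (h : k ≤ j ∨ i ≤ k) :
    topExp ϖ e (Λ.map (1 + u)) k = topExp ϖ e Λ k := by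
  have key : ∀ {Γ : Submodule O M}, IsOpenLattice ϖ Γ → ∀ {v}, v ∈ flagMoves ϖ e i j a →
      topExp ϖ e Γ k ≤ topExp ϖ e (Γ.map (1 + v)) k := fun hΓ _ hv =>
    le_topExp_map hϖ hn hJ hΓ hv hk le_rfl
      (h.imp_right fun h => (topExp_anti hϖ hΓ hn hi h).trans (Nat.le_add_left _ _))
  obtain ⟨v, hv, hvu⟩ := exists_inv_map (Λ := Λ) hJ hu
  refine le_antisymm ?_ (key hΛ hu)
  have := key (hΛ.map_one_add hJ hu) hv
  rwa [hvu] at this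

end Map
end Moves

/-! ### Invariance of the weight -/

section Weight

variable {O : Type*} [CommRing O] [IsDomain O] {n : ℕ}

theorem isClosedUnderMul_pow_smul {ϖ : O} (hϖ : ϖ ≠ 0)
    (mul : (Fin n → O) →ₗ[O] (Fin n → O) →ₗ[O] (Fin n → O)) (Λ : Submodule O (Fin n → O)) (k : ℕ) :
    IsClosedUnderMul mul (ϖ ^ k • Λ) ↔ ∀ x ∈ Λ, ∀ y ∈ Λ, ϖ ^ k • mul x y ∈ Λ := by
  constructor
  · intro h x hx y hy
    obtain ⟨z, hz, hzxy⟩ := (Submodule.mem_smul_pointwise_iff_exists _ _ _).mp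
      (h (ϖ ^ k • x) (Submodule.smul_mem_pointwise_smul x _ _ hx)
        (ϖ ^ k • y) (Submodule.smul_mem_pointwise_smul y _ _ hy))
    rw [map_smul, LinearMap.map_smul₂] at hzxy
    have := smul_right_injective (Fin n → O) (pow_ne_zero k hϖ) hzxy
    rwa [← this]
  · intro h x' hx' y' hy'
    obtain ⟨x, hx, rfl⟩ := (Submodule.mem_smul_pointwise_iff_exists _ _ _).mp hx'
    obtain ⟨y, hy, rfl⟩ := (Submodule.mem_smul_pointwise_iff_exists _ _ _).mp hy'
    rw [map_smul, LinearMap.map_smul₂]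
    exact Submodule.smul_mem_pointwise_smul _ _ _ (h x hx y hy)

theorem hasWeight_iff {ϖ : O} (hϖ : ϖ ≠ 0)
    (mul : (Fin n → O) →ₗ[O] (Fin n → O) →ₗ[O] (Fin n → O)) (Λ : Submodule O (Fin n → O)) (w : ℕ) :
    HasWeight ϖ mul Λ w ↔ (∀ x ∈ Λ, ∀ y ∈ Λ, ϖ ^ w • mul x y ∈ Λ) ∧
      (w ≠ 0 → ¬ ∀ x ∈ Λ, ∀ y ∈ Λ, ϖ ^ (w - 1) • mul x y ∈ Λ) := by
  simp only [HasWeight, isClosedUnderMul_pow_smul hϖ]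
  constructor
  · rintro ⟨h1, h2⟩
    refine ⟨h1, fun hw h => ?_⟩
    have := h2 h
    omega
  · rintro ⟨h1, h2⟩
    refine ⟨h1, fun k hk => ?_⟩
    by_contra! hlt
    refine h2 (by omega) fun x hx y hy => ?_
    have : w - 1 = (w - 1 - k) + k := by omega
    rw [this, pow_add, mul_smul]
    exact Λ.smul_mem _ (hk x hx y hy)

end Weight

section Admissible

variable {O : Type*} [CommRing O] {n : ℕ} {M : Type*} [AddCommGroup M] [Module O M]

/-- Modulo the `i`-th member of the flag, a product only depends on its factors modulo the
previous one, so it is divisible by the square of the power of `ϖ` that divides them there. -/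
theorem exists_mul_eq_add_pow_smul {mul : M →ₗ[O] M →ₗ[O] M} {e : Module.Basis (Fin n) O M}
    (hmul : ShiftsFlag mul e) {ϖ : O} {Λ : Submodule O M} (k : ℕ) {x y : M} (hx : x ∈ Λ)
    (hy : y ∈ Λ) :
    ∃ f ∈ tailFlag e (k + 1), ∃ z, mul x y = f + ϖ ^ (2 * topExp ϖ e Λ k) • z := by
  obtain ⟨f, hf, x', rfl⟩ := exists_add_pow_topExp_smul (ϖ := ϖ) (e := e) k hx
  obtain ⟨g, hg, y', rfl⟩ := exists_add_pow_topExp_smul (ϖ := ϖ) (e := e) k hy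
  refine ⟨mul f (g + ϖ ^ topExp ϖ e Λ k • y') + ϖ ^ topExp ϖ e Λ k • mul x' g,
    add_mem (hmul k _ f hf).2 (Submodule.smul_mem _ _ (hmul k _ g hg).1), mul x' y', ?_⟩
  simp only [map_add, LinearMap.add_apply, map_smul, LinearMap.smul_apply, smul_add]
  rw [two_mul, pow_add, mul_smul]
  abel

/-- Conditions on a pair of indices `(i, j)` under which the moves from above the `i`-th into the
`j`-th member of the flag, scaled by the `a` of `moveExp`, distort the products of elements of `Λ`
only by elements of `ϖ ^ (-v) Λ`. Write `α k` for `topExp` and `β k` for `tailExp`.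
The terms `u x * y`, `x * u y` and `u x * u y` lie in `ϖ ^ (a + α i)` times the `(j + 1)`-st member,
which `tail` controls; `u (x * y)` lies in `ϖ ^ (a + 2 α (i - 1))` times the `j`-th member, which
`top` controls. The condition `gap` says that `a` is a natural number, `gap_lt` that `a ≠ 0` when
the moves need not be nilpotent, and `half` bounds terms of second order in the moves, which arise
only for `j + 1 < i`. For `i = 1` products lie in the `i`-th member, and for `j + 1 = n` the
`(j + 1)`-st member vanishes, so that `top` and `tail` are void. -/
structure IsAdmissible (ϖ : O) (e : Module.Basis (Fin n) O M) (m v : ℕ) (Λ : Submodule O M)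
    (i j : ℕ) : Prop where
  pos : 0 < i
  lt : j < n
  top : i = 1 ∨ m + topExp ϖ e Λ i ≤ v + 2 * topExp ϖ e Λ (i - 1)
  tail : j + 1 = n ∨ m + tailExp ϖ e Λ (j + 1) ≤ v + tailExp ϖ e Λ j
  gap : topExp ϖ e Λ i + m ≤ tailExp ϖ e Λ j
  gap_lt : j < i → topExp ϖ e Λ i + m < tailExp ϖ e Λ j
  half : j + 1 < i → 2 * m + topExp ϖ e Λ i ≤ v + tailExp ϖ e Λ j

/-- The exponent for which the generic element of `flagMoves` moves `Λ` by exactly `ϖ ^ m`. -/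
noncomputable def moveExp (ϖ : O) (e : Module.Basis (Fin n) O M) (m : ℕ) (Λ : Submodule O M)
    (i j : ℕ) : ℕ :=
  tailExp ϖ e Λ j - topExp ϖ e Λ i - m

variable {ϖ : O} {e : Module.Basis (Fin n) O M} {m v i j : ℕ} {Λ : Submodule O M}

theorem IsAdmissible.isQuasiInvertible [IsLocalRing O] [Module.Finite O M] (hϖ : ¬ IsUnit ϖ)
    (h : IsAdmissible ϖ e m v Λ i j) :
    IsQuasiInvertible (flagMoves ϖ e i j (moveExp ϖ e m Λ i j)) := by
  refine isQuasiInvertible_flagMoves hϖ ?_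
  rcases le_or_gt i j with hij | hij
  · exact Or.inl hij
  · have := h.gap_lt hij
    exact Or.inr (by unfold moveExp; omega)

theorem IsAdmissible.tail_map [IsLocalRing O] [Module.Finite O M] (hϖ : ¬ IsUnit ϖ)
    (h : IsAdmissible ϖ e m v Λ i j) (hΛ : IsOpenLattice ϖ Λ) {u : Module.End O M}
    (hu : u ∈ flagMoves ϖ e i j (moveExp ϖ e m Λ i j)) :
    j + 1 = n ∨ m + tailExp ϖ e (Λ.map (1 + u)) (j + 1) ≤ v + tailExp ϖ e Λ j := by
  have h1 := h.tail
  have h2 := h.gap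
  refine h1.imp_right fun h3 => ?_
  have h4 : tailExp ϖ e (Λ.map (1 + u)) (j + 1) ≤ v + tailExp ϖ e Λ j - m := by
    refine tailExp_map_le (h.isQuasiInvertible hϖ) hΛ hu (by omega) ?_
    by_cases hij : i ≤ j + 1
    · exact Or.inl hij
    · have := h.half (by omega)
      right
      unfold moveExp
      omega
  omega

/-- An admissible move changes products by elements of `ϖ ^ (-v)` times the moved lattice. -/
theorem IsAdmissible.pow_smul_sub_mem [IsLocalRing O] [Module.Finite O M] (hϖ : ¬ IsUnit ϖ)
    {mul : M →ₗ[O] M →ₗ[O] M} (hmul : ShiftsFlag mul e)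
    (h : IsAdmissible ϖ e m v Λ i j) (hΛ : IsOpenLattice ϖ Λ) {u : Module.End O M}
    (hu : u ∈ flagMoves ϖ e i j (moveExp ϖ e m Λ i j)) {x y : M} (hx : x ∈ Λ) (hy : y ∈ Λ) :
    ϖ ^ v • (mul ((1 + u) x) ((1 + u) y) - (1 + u) (mul x y)) ∈ Λ.map (1 + u) := by
  have hJ := h.isQuasiInvertible hϖ
  have hΛ' := hΛ.map_one_add hJ hu
  have htail := h.tail_map hϖ hΛ hu
  have hj := tailExp_map_eq hJ hΛ hu (Or.inr le_rfl)
  set a := moveExp ϖ e m Λ i j with ha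
  set A := topExp ϖ e Λ i with hA
  have hgap := h.gap
  have haA : a + A + m = tailExp ϖ e Λ j := by
    rw [ha, moveExp]
    omega
  obtain ⟨x', hx', hux⟩ := apply_eq_pow_smul_of_mem hu hx
  obtain ⟨y', hy', huy⟩ := apply_eq_pow_smul_of_mem hu hy
  rw [← hA] at hux huy
  have h1 : ϖ ^ v • (mul (u x) y + mul x (u y) + mul (u x) (u y)) ∈ Λ.map (1 + u) := by
    have hf : mul x' y + mul x y' + mul x' (u y) ∈ tailFlag e (j + 1) :=
      add_mem (add_mem (hmul j _ x' hx').2 (hmul j _ y' hy').1) (hmul j _ x' hx').2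
    have heq : ϖ ^ v • (mul (u x) y + mul x (u y) + mul (u x) (u y)) =
        ϖ ^ (v + (a + A)) • (mul x' y + mul x y' + mul x' (u y)) := by
      rw [pow_add, mul_smul, hux]
      congr 1
      rw [huy]
      simp only [map_smul, LinearMap.smul_apply, smul_add]
    rw [heq]
    rcases htail with htail | htail
    · rw [eq_zero_of_mem_tailFlag htail.ge hf, smul_zero]
      exact Submodule.zero_mem _
    · exact pow_smul_mem_of_tailExp_le hΛ' (by omega) hf
  have h2 : ϖ ^ v • u (mul x y) ∈ Λ.map (1 + u) := by
    rcases h.top with hi | hi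
    · have hmem : mul x y ∈ tailFlag e i := by
        rw [hi]
        exact (hmul 0 x y (mem_tailFlag_zero y)).1
      rw [hu.1 _ hmem, smul_zero]
      exact Submodule.zero_mem _
    · obtain ⟨f, hf, z, hz⟩ := exists_mul_eq_add_pow_smul hmul (ϖ := ϖ) (i - 1) hx hy
      rw [Nat.sub_add_cancel h.pos] at hf
      obtain ⟨z', hz', hzz'⟩ := hu.2 z
      rw [hz, map_add, hu.1 f hf, zero_add, map_smul, hzz', ← mul_smul, ← mul_smul, ← pow_add,
        ← pow_add]
      refine pow_smul_mem_of_tailExp_le hΛ' ?_ hz'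
      rw [hj]
      omega
  have : mul ((1 + u) x) ((1 + u) y) - (1 + u) (mul x y) =
      mul (u x) y + mul x (u y) + mul (u x) (u y) - u (mul x y) := by
    simp only [LinearMap.add_apply, Module.End.one_apply, map_add]
    abel
  rw [this, smul_sub]
  exact sub_mem h1 h2

theorem IsAdmissible.closed_map_iff [IsLocalRing O] [Module.Finite O M] (hϖ : ¬ IsUnit ϖ)
    {mul : M →ₗ[O] M →ₗ[O] M} (hmul : ShiftsFlag mul e)
    (h : IsAdmissible ϖ e m v Λ i j) (hΛ : IsOpenLattice ϖ Λ) {u : Module.End O M}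
    (hu : u ∈ flagMoves ϖ e i j (moveExp ϖ e m Λ i j)) {k : ℕ} (hk : v ≤ k) :
    (∀ x ∈ Λ.map (1 + u), ∀ y ∈ Λ.map (1 + u), ϖ ^ k • mul x y ∈ Λ.map (1 + u)) ↔
      ∀ x ∈ Λ, ∀ y ∈ Λ, ϖ ^ k • mul x y ∈ Λ := by
  have hinj := (h.isQuasiInvertible hϖ).injective_one_add hu
  have key : ∀ x ∈ Λ, ∀ y ∈ Λ,
      (ϖ ^ k • mul ((1 + u) x) ((1 + u) y) ∈ Λ.map (1 + u) ↔ ϖ ^ k • mul x y ∈ Λ) := by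
    intro x hx y hy
    have h1 := h.pow_smul_sub_mem hϖ hmul hΛ hu hx hy
    have h2 := Submodule.smul_mem _ (ϖ ^ (k - v)) h1
    rw [← mul_smul, ← pow_add, Nat.sub_add_cancel hk, smul_sub] at h2
    rw [← Submodule.sub_mem_iff_left _ h2, sub_sub_cancel, ← map_smul]
    exact ⟨fun ⟨z, hz, hzx⟩ => hinj hzx ▸ hz, Submodule.mem_map_of_mem⟩
  constructor
  · intro H x hx y hy
    exact (key x hx y hy).mp (H _ (Submodule.mem_map_of_mem hx) _ (Submodule.mem_map_of_mem hy))
  · rintro H _ ⟨x, hx, rfl⟩ _ ⟨y, hy, rfl⟩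
    exact (key x hx y hy).mpr (H x hx y hy)

theorem IsAdmissible.hasWeight_map [IsDomain O] [IsLocalRing O] {ϖ : O} (hϖ : Irreducible ϖ)
    {mul : (Fin n → O) →ₗ[O] (Fin n → O) →ₗ[O] (Fin n → O)}
    {e : Module.Basis (Fin n) O (Fin n → O)} (hmul : ShiftsFlag mul e) {w : ℕ}
    {Λ : Submodule O (Fin n → O)} (h : IsAdmissible ϖ e m (w - 1) Λ i j) (hΛ : IsOpenLattice ϖ Λ)
    {u : Module.End O (Fin n → O)} (hu : u ∈ flagMoves ϖ e i j (moveExp ϖ e m Λ i j))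
    (hw : HasWeight ϖ mul Λ w) : HasWeight ϖ mul (Λ.map (1 + u)) w := by
  rw [hasWeight_iff hϖ.ne_zero] at hw ⊢
  rwa [h.closed_map_iff hϖ.not_isUnit hmul hΛ hu (Nat.sub_le w 1),
    h.closed_map_iff hϖ.not_isUnit hmul hΛ hu le_rfl]

/-- The orbit of `Λ` under the admissible moves has size divisible by `q ^ m`: the move taking a
vector of `Λ` whose coordinate is least divisible to a vector of the flag that is deepest outside
`Λ` has order exactly `ϖ ^ m` modulo the stabilizer. -/
theorem IsAdmissible.pow_dvd_ncard [IsDomain O] [IsDiscreteValuationRing O] [Module.Finite O M]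
    (hϖ : Irreducible ϖ) (h : IsAdmissible ϖ e m v Λ i j) (P : Submodule O M) [Finite (M ⧸ P)]
    (hP : ∀ u : Module.End O M, P ≤ P.comap u) (hPΛ : P ≤ Λ) (hΛ : IsOpenLattice ϖ Λ) :
    Nat.card (IsLocalRing.ResidueField O) ^ m ∣
      (unipotentOrbit (flagMoves ϖ e i j (moveExp ϖ e m Λ i j)) Λ).ncard := by
  have hJ := h.isQuasiInvertible hϖ.not_isUnit
  rcases Nat.eq_zero_or_pos m with hm | hm
  · rw [hm, pow_zero]
    exact one_dvd _
  have hgap := h.gap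
  obtain ⟨x, hx, l, hl, c, hc⟩ :=
    exists_repr_eq_pow_topExp_mul_unit (e := e) hϖ hΛ (Nat.zero_lt_of_lt h.lt) h.pos
  obtain ⟨y, hy, hyΛ⟩ : ∃ y ∈ tailFlag e j, ϖ ^ (tailExp ϖ e Λ j - 1) • y ∉ Λ := by
    by_contra! H
    have := tailExp_le H
    omega
  set a := moveExp ϖ e m Λ i j with ha
  set u : Module.End O M := (e.coord l).smulRight (ϖ ^ a • y) with hudef
  have happ : ∀ z, u z = ϖ ^ a • (e.repr z l • y) := fun z => by
    rw [hudef, LinearMap.smulRight_apply, Module.Basis.coord_apply, smul_comm]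
  have hu : u ∈ flagMoves ϖ e i j a := by
    refine ⟨fun z hz => ?_, fun z => ⟨e.repr z l • y, Submodule.smul_mem _ _ hy, happ z⟩⟩
    rw [happ, hz l hl, zero_smul, smul_zero]
  refine hJ.card_residueField_pow_dvd_ncard_unipotentOrbit hϖ P hP hPΛ hu hx fun _ hmem => hyΛ ?_
  rw [happ, hc, ← mul_smul, ← mul_smul] at hmem
  have hexp : ϖ ^ (m - 1) * ϖ ^ a * (ϖ ^ topExp ϖ e Λ i * c) =
      c * ϖ ^ (tailExp ϖ e Λ j - 1) := by
    rw [← mul_assoc, ← pow_add, ← pow_add, mul_comm]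
    congr 2
    rw [ha, moveExp]
    omega
  rw [hexp, mul_smul] at hmem
  have := Λ.smul_mem (↑c⁻¹ : O) hmem
  rwa [← mul_smul, Units.inv_mul, one_smul] at this

end Admissible

/-! ### The choice of the moves -/

section Choice

/-- The numerical core: if `i` is the last index where `α` drops by enough and `j` the first index
where `b` does, then `α i` is so small and `b j` so large that the remaining conditions of
`IsAdmissible` hold. The index `j = 0` has to be excluded when `n = 2` and `w ≠ 0`, because there
`half` can fail by one. -/
theorem gap_of_extremal_indices {α b : ℕ → ℕ} {n m w κ i j : ℕ} (hn : 2 ≤ n) (hm : 1 ≤ m)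
    (hα : ∀ k l, 0 < k → k ≤ l → α l ≤ α k) (hαn : α n = 0) (hb : ∀ k l, k ≤ l → b l ≤ b k)
    (hwb : w ≤ b 0) (hmb : 2 * (n - 1) * m ≤ b 0 + w) (hi : 0 < i) (hin : i ≤ n)
    (htop : i = 1 ∨ m + α i ≤ w - 1 + 2 * α (i - 1))
    (hi_max : ∀ k, i < k → k ≤ n → w - 1 + 2 * α (k - 1) < m + α k) (hjn : j < n)
    (hκj : κ ≤ j) (hj_min : ∀ k, κ ≤ k → k < j → w - 1 + b k < m + b (k + 1))
    (hκ : κ = if n = 2 ∧ w ≠ 0 then 1 else 0)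
    (h2 : n = 2 → b 0 ≤ α 1 + b 1 ∧ (w ≠ 0 → w + 2 * α 1 ≤ b 1)) :
    α i + m ≤ b j ∧ (j < i → α i + m < b j) ∧ (j + 1 < i → 2 * m + α i ≤ w - 1 + b j) := by
  rcases hn.eq_or_lt with rfl | hn3
  · obtain ⟨h3, h4⟩ := h2 rfl
    have hi2 : i = 1 ∨ i = 2 := by omega
    have hj2 : j = 0 ∨ j = 1 := by omega
    by_cases hw : w = 0
    · subst hw
      have hκ0 : κ = 0 := by simpa using hκ
      subst hκ0
      rcases hi2 with rfl | rfl
      · have h5 : 0 - 1 + 2 * α 1 < m + α 2 := hi_max 2 (by omega) (by omega)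
        rcases hj2 with rfl | rfl
        · omega
        · omega
      · rcases hj2 with rfl | rfl
        · omega
        · have h6 : 0 - 1 + b 0 < m + b 1 := hj_min 0 (by omega) (by omega)
          omega
    · have hκ1 : κ = 1 := by simpa [hw] using hκ
      have h4 := h4 hw
      have hj1 : j = 1 := by omega
      subst hj1
      rcases hi2 with rfl | rfl
      · have h5 : w - 1 + 2 * α 1 < m + α 2 := hi_max 2 (by omega) (by omega)
        omega
      · have h6 : m + α 2 ≤ w - 1 + 2 * α 1 := by simpa using htop
        omega
  · have hκ0 : κ = 0 := by
      rw [hκ, if_neg]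
      omega
    subst hκ0
    obtain ⟨N, rfl⟩ : ∃ N, n = N + 1 := ⟨n - 1, by omega⟩
    rw [Nat.add_sub_cancel] at hmb
    have hN : 2 ≤ N := by omega
    -- As `α` is antitone, failure of the condition at `i + 1` bounds `α i` itself.
    have hαi : i = N + 1 ∧ α i = 0 ∨ i ≤ N ∧ α i + (w - 1) < m := by
      rcases hin.eq_or_lt with h | h
      · exact Or.inl ⟨h, h ▸ hαn⟩
      · have h5 := hi_max (i + 1) (by omega) h
        have h6 := hα i (i + 1) hi (by omega)
        rw [Nat.add_sub_cancel] at h5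
        exact Or.inr ⟨by omega, by omega⟩
    rcases Nat.eq_zero_or_pos j with rfl | hj
    · have h7 : 2 * 2 * m ≤ 2 * N * m := by gcongr
      omega
    · have h5 := hj_min 0 (Nat.zero_le _) hj
      have h6 := hb 0 (0 + 1) (by omega)
      obtain ⟨s, hs⟩ : ∃ s, m = (w - 1) + 1 + s := ⟨m - (w - 1 + 1), by omega⟩
      -- Below `j` the exponents `b` drop by at most `s = m - 1 - (w - 1)` at each step.
      have hchain : ∀ k, k ≤ j → b 0 ≤ b k + k * s := by
        intro k
        induction k with
        | zero => intro _; omega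
        | succ k ih =>
          intro hk
          have h7 := ih (by omega)
          have h8 := hj_min k (Nat.zero_le _) (by omega)
          rw [add_mul, one_mul]
          omega
      have h7 := hchain j le_rfl
      have hprod : 2 * N * m = N * m + N * (w - 1) + N + N * s := by
        rw [two_mul, add_mul]
        nth_rewrite 2 [hs]
        ring
      have hNm : 2 * m ≤ N * m := Nat.mul_le_mul_right m hN
      have hNw : 2 * (w - 1) ≤ N * (w - 1) := Nat.mul_le_mul_right _ hN
      have hj' : j = N ∨ j + 1 ≤ N := by omega
      rcases hj' with rfl | hj'
      · omega
      · have hjs : (j + 1) * s ≤ N * s := Nat.mul_le_mul_right s hj'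
        rw [add_mul, one_mul] at hjs
        omega

variable {O : Type*} [CommRing O] {M : Type*} [AddCommGroup M] [Module O M] {n : ℕ}

open Classical in
/-- The last index at which `topExp` satisfies the condition `IsAdmissible.top`. -/
noncomputable def topIndex (ϖ : O) (e : Module.Basis (Fin n) O M) (m v : ℕ) (Λ : Submodule O M) :
    ℕ :=
  Nat.findGreatest
    (fun i => i = 1 ∨ m + topExp ϖ e Λ i ≤ v + 2 * topExp ϖ e Λ (i - 1)) n

/-- The first index, from `κ` on, at which `tailExp` satisfies the condition
`IsAdmissible.tail`. -/
noncomputable def tailIndex (ϖ : O) (e : Module.Basis (Fin n) O M) (m v κ : ℕ)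
    (Λ : Submodule O M) : ℕ :=
  sInf {j | κ ≤ j ∧ (j + 1 = n ∨ m + tailExp ϖ e Λ (j + 1) ≤ v + tailExp ϖ e Λ j)}

variable {ϖ : O} {e : Module.Basis (Fin n) O M} {m v κ : ℕ} {Λ : Submodule O M}

theorem topIndex_eq_iff {i : ℕ} (hi : i ≠ 0) : topIndex ϖ e m v Λ = i ↔ i ≤ n ∧
    (i = 1 ∨ m + topExp ϖ e Λ i ≤ v + 2 * topExp ϖ e Λ (i - 1)) ∧
    ∀ k, i < k → k ≤ n → v + 2 * topExp ϖ e Λ (k - 1) < m + topExp ϖ e Λ k := by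
  classical
  rw [topIndex, Nat.findGreatest_eq_iff]
  refine and_congr_right fun _ => and_congr ⟨fun h => h hi, fun h _ => h⟩ ?_
  refine forall_congr' fun k => ⟨fun h h1 h2 => ?_, fun h h1 h2 => ?_⟩
  · have := h h1 h2
    omega
  · have := h h1 h2
    omega

theorem topIndex_pos (hn : 0 < n) : 0 < topIndex ϖ e m v Λ := by
  classical
  exact Nat.le_findGreatest hn (Or.inl rfl)

theorem tailIndex_mem (hκ : κ < n) : tailIndex ϖ e m v κ Λ ∈
    {j | κ ≤ j ∧ (j + 1 = n ∨ m + tailExp ϖ e Λ (j + 1) ≤ v + tailExp ϖ e Λ j)} :=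
  Nat.sInf_mem ⟨n - 1, by omega, Or.inl (by omega)⟩

theorem tailIndex_lt (hκ : κ < n) : tailIndex ϖ e m v κ Λ < n := by
  have : tailIndex ϖ e m v κ Λ ≤ n - 1 := Nat.sInf_le ⟨by omega, Or.inl (by omega)⟩
  omega

theorem lt_of_lt_tailIndex {k : ℕ} (hk : κ ≤ k) (h : k < tailIndex ϖ e m v κ Λ) :
    v + tailExp ϖ e Λ k < m + tailExp ϖ e Λ (k + 1) := by
  have h1 := Nat.notMem_of_lt_sInf h
  by_contra! h2
  exact h1 ⟨hk, Or.inr h2⟩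

variable [IsLocalRing O] [Module.Finite O M]

/-- The choice of `i` only looks at `topExp` from index `i - 1` on. The moves fix these values,
except for the one at `i - 1` when `j + 1 < i`; there `half` keeps it large enough. -/
theorem IsAdmissible.topIndex_map [IsDomain O] (hϖ : Irreducible ϖ) {i j : ℕ}
    (h : IsAdmissible ϖ e m v Λ i j)
    (hi : topIndex ϖ e m v Λ = i) (hΛ : IsOpenLattice ϖ Λ) {u : Module.End O M}
    (hu : u ∈ flagMoves ϖ e i j (moveExp ϖ e m Λ i j)) :
    topIndex ϖ e m v (Λ.map (1 + u)) = i := by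
  have hJ := h.isQuasiInvertible hϖ.not_isUnit
  have hn := Nat.zero_lt_of_lt h.lt
  rw [topIndex_eq_iff h.pos.ne'] at hi ⊢
  have heq : ∀ k, i ≤ k → topExp ϖ e (Λ.map (1 + u)) k = topExp ϖ e Λ k := fun k hk =>
    topExp_map_eq hϖ hn hJ hΛ hu h.pos (h.pos.trans_le hk) (Or.inr hk)
  refine ⟨hi.1, or_iff_not_imp_left.mpr fun hi1 => ?_, fun k hik hkn => ?_⟩
  · have htop := hi.2.1.resolve_left hi1
    rw [heq i le_rfl]
    have h0 : 0 < i - 1 := by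
      have := h.pos
      omega
    by_cases hij : i - 1 ≤ j
    · rwa [topExp_map_eq hϖ hn hJ hΛ hu h.pos h0 (Or.inl hij)]
    · have h1 := h.half (by omega)
      have h2 := h.gap
      have h3 := le_topExp_map hϖ hn hJ hΛ hu h0
        (min_le_left (topExp ϖ e Λ (i - 1)) (moveExp ϖ e m Λ i j + topExp ϖ e Λ i))
        (Or.inr (min_le_right _ _))
      unfold moveExp at h3
      omega
  · rw [heq k hik.le, heq (k - 1) (by omega)]
    exact hi.2.2 k hik hkn

theorem IsAdmissible.tailIndex_map (hϖ : Irreducible ϖ) {i j : ℕ}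
    (h : IsAdmissible ϖ e m v Λ i j) (hκ : κ < n) (hj : tailIndex ϖ e m v κ Λ = j)
    (hΛ : IsOpenLattice ϖ Λ) {u : Module.End O M}
    (hu : u ∈ flagMoves ϖ e i j (moveExp ϖ e m Λ i j)) :
    tailIndex ϖ e m v κ (Λ.map (1 + u)) = j := by
  have hJ := h.isQuasiInvertible hϖ.not_isUnit
  have heq : ∀ k, k ≤ j → tailExp ϖ e (Λ.map (1 + u)) k = tailExp ϖ e Λ k := fun k hk =>
    tailExp_map_eq hJ hΛ hu (Or.inr hk)
  have hκj : κ ≤ j := hj ▸ (tailIndex_mem hκ).1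
  refine le_antisymm (Nat.sInf_le ⟨hκj, ?_⟩) ?_
  · rw [heq j le_rfl]
    exact h.tail_map hϖ.not_isUnit hΛ hu
  · by_contra! hlt
    have h1 := tailIndex_mem (ϖ := ϖ) (e := e) (m := m) (v := v) (Λ := Λ.map (1 + u)) hκ
    set k := tailIndex ϖ e m v κ (Λ.map (1 + u)) with hk
    obtain ⟨h2, h3⟩ := h1
    rw [heq k hlt.le, heq (k + 1) hlt] at h3
    have h4 := lt_of_lt_tailIndex h2 (hj ▸ hlt)
    have h5 := h.lt
    omega

theorem IsAdmissible.moveExp_map [IsDomain O] (hϖ : Irreducible ϖ) {i j : ℕ}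
    (h : IsAdmissible ϖ e m v Λ i j)
    (hΛ : IsOpenLattice ϖ Λ) {u : Module.End O M}
    (hu : u ∈ flagMoves ϖ e i j (moveExp ϖ e m Λ i j)) :
    moveExp ϖ e m (Λ.map (1 + u)) i j = moveExp ϖ e m Λ i j := by
  have hJ := h.isQuasiInvertible hϖ.not_isUnit
  rw [moveExp, moveExp, tailExp_map_eq hJ hΛ hu (Or.inr le_rfl),
    topExp_map_eq hϖ (Nat.zero_lt_of_lt h.lt) hJ hΛ hu h.pos h.pos (Or.inr le_rfl)]

end Choice

/-! ### The homogeneous basis of a graded algebra -/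

/-- A homogeneous basis, ordered by degree, has the required flag: all degrees are positive, so
multiplication strictly raises them. -/
theorem exists_shiftsFlag_of_isGradedMul {O : Type*} [CommRing O] [IsDomain O] {n : ℕ}
    {mul : (Fin n → O) →ₗ[O] (Fin n → O) →ₗ[O] (Fin n → O)} (h : IsGradedMul mul) :
    ∃ e : Module.Basis (Fin n) O (Fin n → O), ShiftsFlag mul e := by
  obtain ⟨A, hA, hfree, hmul⟩ := h
  let c := hA.collectedBasis fun j => Module.Free.chooseBasis O (A j)
  let s : Fin n ≃ Σ j : ℕ+, Module.Free.ChooseBasisIndex O (A j) :=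
    (Pi.basisFun O (Fin n)).indexEquiv c
  let d : Fin n → ℕ+ := fun k => (s k).1
  let σ : Equiv.Perm (Fin n) := Tuple.sort d
  have hmono : Monotone (d ∘ σ) := Tuple.monotone_sort d
  let e : Module.Basis (Fin n) O (Fin n → O) := c.reindex (σ.trans s).symm
  have he : ∀ k, e k ∈ A (d (σ k)) := fun k => by
    rw [Module.Basis.reindex_apply]
    exact hA.collectedBasis_mem _ _
  have hrepr : ∀ {j x k}, x ∈ A j → d (σ k) < j → e.repr x k = 0 := fun {j x k} hx hk => by
    rw [Module.Basis.repr_reindex_apply]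
    exact hA.collectedBasis_repr_of_mem_ne _ hk.ne' hx
  have hmem : ∀ (k : ℕ) (l p : Fin n), k ≤ l → mul (e p) (e l) ∈ tailFlag e (k + 1) ∧
      mul (e l) (e p) ∈ tailFlag e (k + 1) := by
    intro k l p hkl
    have hlt : ∀ t : Fin n, (t : ℕ) < k + 1 → d (σ t) ≤ d (σ l) := fun t ht =>
      hmono (Fin.le_def.mpr (by omega))
    exact ⟨fun t ht => hrepr (hmul _ _ _ (he p) _ (he l))
        ((hlt t ht).trans_lt (PNat.lt_add_left _ _)),
      fun t ht => hrepr (hmul _ _ _ (he l) _ (he p))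
        ((hlt t ht).trans_lt (PNat.lt_add_right _ _))⟩
  refine ⟨e, fun k x y hy => ?_⟩
  have hterm : ∀ l p, e.repr y l • (e.repr x p • mul (e p) (e l)) ∈ tailFlag e (k + 1) ∧
      e.repr y l • (e.repr x p • mul (e l) (e p)) ∈ tailFlag e (k + 1) := by
    intro l p
    by_cases hkl : k ≤ l
    · exact ⟨Submodule.smul_mem _ _ (Submodule.smul_mem _ _ (hmem k l p hkl).1),
        Submodule.smul_mem _ _ (Submodule.smul_mem _ _ (hmem k l p hkl).2)⟩
    · rw [hy l (not_le.mp hkl), zero_smul, zero_smul]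
      exact ⟨zero_mem _, zero_mem _⟩
  rw [← e.sum_repr x, ← e.sum_repr y]
  simp only [map_sum, map_smul, LinearMap.sum_apply, LinearMap.smul_apply, Finset.smul_sum]
  constructor
  · refine Submodule.sum_mem _ fun l _ => Submodule.sum_mem _ fun p _ => ?_
    exact (hterm l p).1
  · refine Submodule.sum_mem _ fun l _ => Submodule.sum_mem _ fun p _ => ?_
    rw [smul_comm]
    exact (hterm p l).2

/-! ### Primitive lattices of a given type -/

section Lattices

variable {O : Type*} [CommRing O] {n : ℕ} {ϖ : O} {Λ : Submodule O (Fin n → O)}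

theorem IsFullLattice.map_equiv (h : IsFullLattice Λ) (g : (Fin n → O) ≃ₗ[O] (Fin n → O)) :
    IsFullLattice (Λ.map (g : (Fin n → O) →ₗ[O] (Fin n → O))) := by
  unfold IsFullLattice at h ⊢
  rw [LinearEquiv.finrank_map_eq, h]

theorem IsPrimitiveLattice.map_equiv (h : IsPrimitiveLattice ϖ Λ)
    (g : (Fin n → O) ≃ₗ[O] (Fin n → O)) :
    IsPrimitiveLattice ϖ (Λ.map (g : (Fin n → O) →ₗ[O] (Fin n → O))) := by
  refine fun H => h fun x hx => ?_
  obtain ⟨y, -, hy⟩ := (Submodule.mem_smul_pointwise_iff_exists _ _ _).mp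
    (H (Submodule.mem_map_of_mem hx))
  refine (Submodule.mem_smul_pointwise_iff_exists _ _ _).mpr ⟨g.symm y, trivial, g.injective ?_⟩
  rw [map_smul, LinearEquiv.apply_symm_apply, hy]
  rfl

theorem HasElementaryDivisorType.map_equiv {I : Finset ℕ} {r : ℕ → ℕ}
    (h : HasElementaryDivisorType ϖ Λ I r) (g : (Fin n → O) ≃ₗ[O] (Fin n → O)) :
    HasElementaryDivisorType ϖ (Λ.map (g : (Fin n → O) →ₗ[O] (Fin n → O))) I r := by
  obtain ⟨lam, ⟨hanti, b, hb⟩, hI⟩ := h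
  refine ⟨lam, ⟨hanti, b.map g, ?_⟩, hI⟩
  rw [hb, Submodule.map_span, ← Set.range_comp]
  congr 2
  ext1 i
  simp

theorem HasElementaryDivisors.dvd_repr {b : Module.Basis (Fin n) O (Fin n → O)} {lam : ℕ → ℕ}
    {x : Fin n → O}
    (hx : x ∈ Submodule.span O (Set.range fun i : Fin n => ϖ ^ lam (i.val + 1) • b i)) (i : Fin n) :
    ϖ ^ lam (i.val + 1) ∣ b.repr x i := by
  induction hx using Submodule.span_induction with
  | mem x hx =>
    obtain ⟨k, rfl⟩ := hx
    rw [map_smul, Finsupp.smul_apply, Module.Basis.repr_self, Finsupp.single_apply]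
    split_ifs with h
    · rw [h]
      exact dvd_mul_right _ _
    · rw [smul_zero]
      exact dvd_zero _
  | zero => simp
  | add x y _ _ hx hy =>
    rw [map_add]
    exact dvd_add hx hy
  | smul c x _ hx =>
    rw [map_smul]
    exact hx.mul_left c

/-- For a primitive lattice the exponents of the elementary divisors are bounded in terms of the
type. -/
theorem pow_smul_mem_of_type (hn : 0 < n) (hprim : IsPrimitiveLattice ϖ Λ) {I : Finset ℕ}
    {r : ℕ → ℕ} (h : HasElementaryDivisorType ϖ Λ I r) (x : Fin n → O) :
    ϖ ^ ((n - 1) * I.sup r) • x ∈ Λ := by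
  obtain ⟨lam, ⟨hanti, b, hb⟩, hI, hr⟩ := h
  have hlast : lam n = 0 := by
    by_contra hne
    refine hprim ?_
    rw [hb, Submodule.span_le]
    rintro _ ⟨i, rfl⟩
    have h1 : lam n ≤ lam (i.val + 1) :=
      hanti (Set.mem_Icc.mpr (by omega)) (Set.mem_Icc.mpr (by omega)) i.2
    refine (Submodule.mem_smul_pointwise_iff_exists _ _ _).mpr
      ⟨ϖ ^ (lam (i.val + 1) - 1) • b i, trivial, ?_⟩
    rw [← mul_smul, ← pow_succ', Nat.sub_add_cancel (by omega)]
  have hstep : ∀ ι, 1 ≤ ι → ι < n → lam ι ≤ lam (ι + 1) + I.sup r := by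
    intro ι h1 h2
    by_cases hι : ι ∈ I
    · have := Finset.le_sup (f := r) hι
      have := hr ι hι
      omega
    · have h3 : ¬ lam (ι + 1) < lam ι := fun h3 =>
        hι ((hI ι).mpr ⟨Finset.mem_Icc.mpr (by omega), h3⟩)
      omega
  have hbound : ∀ k, k < n → lam (n - k) ≤ k * I.sup r := by
    intro k
    induction k with
    | zero => intro _; simp [hlast]
    | succ k ih =>
      intro hk
      have h1 := hstep (n - (k + 1)) (by omega) (by omega)
      have h2 : n - (k + 1) + 1 = n - k := by omega
      rw [h2] at h1
      have := ih (by omega)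
      rw [add_mul, one_mul]
      omega
  rw [← b.sum_repr x, Finset.smul_sum]
  refine Submodule.sum_mem _ fun i _ => ?_
  have h1 : lam (i.val + 1) ≤ (n - 1) * I.sup r := by
    have h2 := hbound (n - (i.val + 1)) (by omega)
    have h3 : n - (n - (i.val + 1)) = i.val + 1 := by omega
    rw [h3] at h2
    exact h2.trans (Nat.mul_le_mul_right _ (by omega))
  rw [smul_comm, ← Nat.sub_add_cancel h1, pow_add, mul_smul]
  refine Submodule.smul_mem _ _ (Submodule.smul_mem _ _ ?_)
  rw [hb]
  exact Submodule.subset_span ⟨i, rfl⟩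

/-- The largest jump of a type is at most the exponent of the quotient by the lattice. -/
theorem sup_le_of_pow_smul_mem [IsDomain O] (hϖ : Irreducible ϖ) {I : Finset ℕ} {r : ℕ → ℕ}
    (h : HasElementaryDivisorType ϖ Λ I r) {t : ℕ} (ht : ∀ x, ϖ ^ t • x ∈ Λ) : I.sup r ≤ t := by
  obtain ⟨lam, ⟨hanti, b, hb⟩, hI, hr⟩ := h
  refine Finset.sup_le fun ι hι => ?_
  have h1 := Finset.mem_Icc.mp ((hI ι).mp hι).1
  have h2 := hr ι hι
  have h3 : lam ι ≤ lam (0 + 1) := hanti (Set.mem_Icc.mpr (by omega)) (Set.mem_Icc.mpr (by omega))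
    (by omega)
  have h4 := ht (b ⟨0, by omega⟩)
  rw [hb] at h4
  have h5 := HasElementaryDivisors.dvd_repr h4 ⟨0, by omega⟩
  rw [map_smul, Finsupp.smul_apply, Module.Basis.repr_self, Finsupp.single_eq_same, smul_eq_mul,
    mul_one, pow_dvd_pow_iff hϖ.ne_zero hϖ.not_isUnit] at h5
  have h6 : lam (0 + 1) ≤ t := h5
  omega

theorem topExp_eq_zero_of_primitive (h : IsPrimitiveLattice ϖ Λ)
    (e : Module.Basis (Fin n) O (Fin n → O)) : topExp ϖ e Λ n = 0 := by
  by_contra hne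
  refine h fun x hx => ?_
  obtain ⟨f, hf, y, rfl⟩ := exists_add_pow_topExp_smul (ϖ := ϖ) (e := e) n hx
  refine (Submodule.mem_smul_pointwise_iff_exists _ _ _).mpr
    ⟨ϖ ^ (topExp ϖ e Λ n - 1) • y, trivial, ?_⟩
  rw [eq_zero_of_mem_tailFlag le_rfl hf, zero_add, ← mul_smul, ← pow_succ',
    Nat.sub_add_cancel (Nat.pos_of_ne_zero hne)]

/-- The part of the flag above its first member has rank one, so `Λ` contains a vector that is
`ϖ ^ topExp ϖ e Λ 1` times the leading basis vector modulo the first member. -/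
theorem tailExp_zero_le [IsDomain O] [IsDiscreteValuationRing O] {M : Type*} [AddCommGroup M]
    [Module O M] (hϖ : Irreducible ϖ) {Λ : Submodule O M} (hΛ : IsOpenLattice ϖ Λ) (hn : 0 < n)
    (e : Module.Basis (Fin n) O M) :
    tailExp ϖ e Λ 0 ≤ topExp ϖ e Λ 1 + tailExp ϖ e Λ 1 := by
  obtain ⟨z, hz, l, hl, c, hc⟩ := exists_repr_eq_pow_topExp_mul_unit (e := e) hϖ hΛ hn one_pos
  refine tailExp_le fun x _ => ?_
  have hmem : ϖ ^ topExp ϖ e Λ 1 • x - (e.repr x l * ↑c⁻¹) • z ∈ tailFlag e 1 := by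
    intro k hk
    have hkl : k = l := Fin.ext (by omega)
    rw [hkl, map_sub, map_smul, map_smul, Finsupp.sub_apply, Finsupp.smul_apply,
      Finsupp.smul_apply, hc, smul_eq_mul, smul_eq_mul, mul_comm (ϖ ^ _) (c : O), mul_assoc,
      Units.inv_mul_cancel_left, mul_comm, sub_self]
  have h1 := pow_smul_mem_of_tailExp_le hΛ le_rfl hmem
  rw [smul_sub, ← mul_smul, ← pow_add, add_comm] at h1
  exact (Submodule.sub_mem_iff_left _ (Λ.smul_mem _ (Λ.smul_mem _ hz))).mp h1

variable [IsDomain O] {mul : (Fin n → O) →ₗ[O] (Fin n → O) →ₗ[O] (Fin n → O)} {w : ℕ}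
  {e : Module.Basis (Fin n) O (Fin n → O)}

theorem HasWeight.le_tailExp_zero (hϖ : Irreducible ϖ) (hw : HasWeight ϖ mul Λ w)
    (hΛ : IsOpenLattice ϖ Λ) : w ≤ tailExp ϖ e Λ 0 := by
  refine hw.2 ((isClosedUnderMul_pow_smul hϖ.ne_zero mul Λ _).mpr fun x _ y _ => ?_)
  exact pow_smul_mem_of_tailExp_le hΛ le_rfl (mem_tailFlag_zero _)

/-- In rank `2` all products of elements of `Λ` lie in `ϖ ^ (2 α)` times the line that is the first
member of the flag, where `α = topExp ϖ e Λ 1`. -/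
theorem HasWeight.add_two_mul_topExp_le {e : Module.Basis (Fin 2) O (Fin 2 → O)}
    {mul : (Fin 2 → O) →ₗ[O] (Fin 2 → O) →ₗ[O] (Fin 2 → O)} {Λ : Submodule O (Fin 2 → O)}
    (hϖ : Irreducible ϖ) (hmul : ShiftsFlag mul e) (hw : HasWeight ϖ mul Λ w)
    (hΛ : IsOpenLattice ϖ Λ) (hw0 : w ≠ 0) : w + 2 * topExp ϖ e Λ 1 ≤ tailExp ϖ e Λ 1 := by
  by_contra! hlt
  refine ((hasWeight_iff hϖ.ne_zero mul Λ w).mp hw).2 hw0 fun x hx y hy => ?_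
  obtain ⟨f, hf, z, hz⟩ := exists_mul_eq_add_pow_smul hmul (ϖ := ϖ) 1 hx hy
  rw [eq_zero_of_mem_tailFlag (by norm_num) hf, zero_add] at hz
  have hz' : z ∈ tailFlag e 1 := by
    intro l hl
    have h1 := (hmul 0 x y (mem_tailFlag_zero y)).1 l hl
    rw [hz, map_smul, Finsupp.smul_apply, smul_eq_mul] at h1
    exact (mul_eq_zero.mp h1).resolve_left (pow_ne_zero _ hϖ.ne_zero)
  rw [hz, ← mul_smul, ← pow_add]
  exact pow_smul_mem_of_tailExp_le hΛ (by omega) hz'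

end Lattices

/-! ### Divisibility of the number of lattices -/

section Count

variable {O : Type*} [CommRing O] {n : ℕ} {ϖ : O}
  {mul : (Fin n → O) →ₗ[O] (Fin n → O) →ₗ[O] (Fin n → O)}
  {I : Finset ℕ} {r : ℕ → ℕ} {w : ℕ}

theorem range_lsmul_le_of_mem_primitiveLattices (hn : 0 < n) {Λ : Submodule O (Fin n → O)}
    (h : Λ ∈ primitiveLattices ϖ mul I r w) :
    LinearMap.range (LinearMap.lsmul O (Fin n → O) (ϖ ^ ((n - 1) * I.sup r))) ≤ Λ := by
  rintro _ ⟨x, rfl⟩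
  exact pow_smul_mem_of_type hn h.2.1 h.2.2.1 x

theorem isOpenLattice_of_mem_primitiveLattices (hn : 0 < n) {Λ : Submodule O (Fin n → O)}
    (h : Λ ∈ primitiveLattices ϖ mul I r w) : IsOpenLattice ϖ Λ :=
  ⟨_, pow_smul_mem_of_type hn h.2.1 h.2.2.1⟩

variable [IsDomain O] [IsDiscreteValuationRing O]

theorem finite_quotient_range_lsmul [TopologicalSpace O] [IsTopologicalRing O] [CompactSpace O]
    (hadic : IsAdic (IsLocalRing.maximalIdeal O)) (hϖ : Irreducible ϖ) (k : ℕ) :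
    Finite ((Fin n → O) ⧸ LinearMap.range (LinearMap.lsmul O (Fin n → O) (ϖ ^ k))) := by
  have h1 := finite_quotient_pow_of_isAdic hadic k
  let f : (Fin n → O) →ₗ[O] (Fin n → O ⧸ IsLocalRing.maximalIdeal O ^ k) :=
    LinearMap.pi fun i => (Submodule.mkQ (IsLocalRing.maximalIdeal O ^ k)).comp (LinearMap.proj i)
  have hker : LinearMap.ker f ≤ LinearMap.range (LinearMap.lsmul O (Fin n → O) (ϖ ^ k)) := by
    intro x hx
    have h2 : ∀ i, ϖ ^ k ∣ x i := fun i => by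
      have h3 := congrFun (LinearMap.mem_ker.mp hx) i
      have h4 : x i ∈ IsLocalRing.maximalIdeal O ^ k := (Submodule.Quotient.mk_eq_zero _).mp h3
      rwa [hϖ.maximalIdeal_eq, Ideal.span_singleton_pow, Ideal.mem_span_singleton] at h4
    choose y hy using h2
    exact ⟨y, funext fun i => (hy i).symm⟩
  have : Finite ((Fin n → O) ⧸ LinearMap.ker f) :=
    Finite.of_equiv _ f.quotKerEquivRange.symm.toEquiv
  exact Finite.of_surjective _ (Submodule.factor_surjective hker)

theorem finite_primitiveLattices [TopologicalSpace O] [IsTopologicalRing O] [CompactSpace O]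
    (hadic : IsAdic (IsLocalRing.maximalIdeal O)) (hϖ : Irreducible ϖ) (hn : 0 < n) :
    (primitiveLattices ϖ mul I r w).Finite := by
  set P := LinearMap.range (LinearMap.lsmul O (Fin n → O) (ϖ ^ ((n - 1) * I.sup r))) with hP
  have : Finite ((Fin n → O) ⧸ P) := finite_quotient_range_lsmul hadic hϖ _
  have : Finite (Submodule O ((Fin n → O) ⧸ P)) :=
    Finite.of_injective (fun Γ => (Γ : Set ((Fin n → O) ⧸ P))) SetLike.coe_injective
  refine Set.Finite.of_injOn (f := fun Λ => Λ.map P.mkQ) (t := Set.univ)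
    (fun _ _ => Set.mem_univ _) (fun Λ hΛ Γ hΓ h => ?_) Set.finite_univ
  have hle : ∀ Γ ∈ primitiveLattices ϖ mul I r w, P ≤ Γ := fun Γ hΓ =>
    range_lsmul_le_of_mem_primitiveLattices hn hΓ
  have h' : (Λ.map P.mkQ).comap P.mkQ = (Γ.map P.mkQ).comap P.mkQ := congrArg _ h
  rwa [Submodule.comap_map_mkQ, Submodule.comap_map_mkQ, sup_eq_right.mpr (hle Λ hΛ),
    sup_eq_right.mpr (hle Γ hΓ)] at h'

theorem isAdmissible_of_mem_primitiveLattices (hϖ : Irreducible ϖ) (hn : 2 ≤ n)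
    {e : Module.Basis (Fin n) O (Fin n → O)} (hmul : ShiftsFlag mul e)
    {m : ℕ} (hm : 1 ≤ m) (hmb : 2 * (n - 1) * m ≤ I.sup r + w) {κ : ℕ}
    (hκ : κ = if n = 2 ∧ w ≠ 0 then 1 else 0)
    {Λ : Submodule O (Fin n → O)} (h : Λ ∈ primitiveLattices ϖ mul I r w) :
    IsAdmissible ϖ e m (w - 1) Λ (topIndex ϖ e m (w - 1) Λ) (tailIndex ϖ e m (w - 1) κ Λ) := by
  have hn0 : 0 < n := by omega
  have hΛ := isOpenLattice_of_mem_primitiveLattices hn0 h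
  have hκn : κ < n := by
    rw [hκ]
    split_ifs <;> omega
  have hpos : 0 < topIndex ϖ e m (w - 1) Λ := topIndex_pos hn0
  obtain ⟨hle, htop, hmax⟩ := (topIndex_eq_iff hpos.ne').mp
    (rfl : topIndex ϖ e m (w - 1) Λ = topIndex ϖ e m (w - 1) Λ)
  obtain ⟨hκj, htail⟩ := tailIndex_mem (ϖ := ϖ) (e := e) (m := m) (v := w - 1) (Λ := Λ) hκn
  have hlt : tailIndex ϖ e m (w - 1) κ Λ < n := tailIndex_lt hκn
  have hR : I.sup r ≤ tailExp ϖ e Λ 0 := sup_le_of_pow_smul_mem hϖ h.2.2.1 fun x =>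
    pow_smul_mem_of_tailExp_le hΛ le_rfl (mem_tailFlag_zero x)
  obtain ⟨h1, h2, h3⟩ := gap_of_extremal_indices (α := topExp ϖ e Λ) (b := tailExp ϖ e Λ) hn hm
    (fun k l hk hkl => topExp_anti hϖ hΛ hn0 hk hkl) (topExp_eq_zero_of_primitive h.2.1 e)
    (fun k l hkl => tailExp_anti hΛ hkl) (h.2.2.2.le_tailExp_zero hϖ hΛ)
    (hmb.trans (Nat.add_le_add_right hR w)) hpos hle htop hmax hlt hκj
    (fun k hk hkj => lt_of_lt_tailIndex hk hkj) hκ (by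
      rintro rfl
      exact ⟨tailExp_zero_le hϖ hΛ hn0 e, h.2.2.2.add_two_mul_topExp_le hϖ hmul hΛ⟩)
  exact ⟨hpos, hlt, htop, htail, h1, h2, h3⟩

/-- Admissible moves permute the primitive lattices of given type and weight. -/
theorem IsAdmissible.map_mem_primitiveLattices (hϖ : Irreducible ϖ) (hn : 0 < n)
    {e : Module.Basis (Fin n) O (Fin n → O)} (hmul : ShiftsFlag mul e) {m i j : ℕ}
    {Λ : Submodule O (Fin n → O)} (h : IsAdmissible ϖ e m (w - 1) Λ i j)
    (hmem : Λ ∈ primitiveLattices ϖ mul I r w) {u : Module.End O (Fin n → O)}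
    (hu : u ∈ flagMoves ϖ e i j (moveExp ϖ e m Λ i j)) :
    Λ.map (1 + u) ∈ primitiveLattices ϖ mul I r w := by
  obtain ⟨v, -, h1, h2⟩ := (h.isQuasiInvertible hϖ.not_isUnit).exists_two_sided_inv hu
  let g : (Fin n → O) ≃ₗ[O] (Fin n → O) := LinearEquiv.ofLinearMap (1 + u) (1 + v) h1 h2
  exact ⟨hmem.1.map_equiv g, hmem.2.1.map_equiv g, hmem.2.2.1.map_equiv g,
    h.hasWeight_map hϖ hmul (isOpenLattice_of_mem_primitiveLattices hn hmem) hu hmem.2.2.2⟩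

end Count

theorem mainTheorem5 {O : Type*} [CommRing O] [IsDomain O] [IsDiscreteValuationRing O] [CharZero O]
    [TopologicalSpace O] [IsTopologicalRing O] [CompactSpace O]
    (hadic : IsAdic (IsLocalRing.maximalIdeal O))
    (ϖ : O) (hϖ : Irreducible ϖ)
    (n : ℕ) (hn : 2 ≤ n)
    (mul : (Fin n → O) →ₗ[O] (Fin n → O) →ₗ[O] (Fin n → O))
    (hgr : IsGradedMul mul)
    (I : Finset ℕ) (hI : I ⊆ Finset.Icc 1 (n - 1))
    (r : ℕ → ℕ) (hr : ∀ ι ∈ I, 0 < r ι)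
    (w : ℕ) :
    (primitiveLattices ϖ mul I r w).Finite ∧
    (((I.sup r + w) / (2 * (n - 1)) : ℕ) : ℕ∞) ≤
      emultiplicity (Nat.card (IsLocalRing.ResidueField O))
        (primitiveLattices ϖ mul I r w).ncard := by
  have hn0 : 0 < n := by omega
  refine ⟨finite_primitiveLattices hadic hϖ hn0, le_emultiplicity_of_pow_dvd ?_⟩
  set m := (I.sup r + w) / (2 * (n - 1)) with hm
  rcases Nat.eq_zero_or_pos m with hm0 | hm0
  · rw [hm0, pow_zero]
    exact one_dvd _
  have hmb : 2 * (n - 1) * m ≤ I.sup r + w := Nat.mul_div_le _ _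
  obtain ⟨e, hmul⟩ := exists_shiftsFlag_of_isGradedMul hgr
  -- The start of the search for `j`; see `gap_of_extremal_indices`.
  obtain ⟨κ, hκ⟩ : ∃ κ, κ = if n = 2 ∧ w ≠ 0 then 1 else 0 := ⟨_, rfl⟩
  have hκn : κ < n := by
    rw [hκ]
    split_ifs <;> omega
  let i := topIndex ϖ e m (w - 1)
  let j := tailIndex ϖ e m (w - 1) κ
  let J : Submodule O (Fin n → O) → Submodule O (Module.End O (Fin n → O)) := fun Λ =>
    flagMoves ϖ e (i Λ) (j Λ) (moveExp ϖ e m Λ (i Λ) (j Λ))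
  have hadm : ∀ Λ ∈ primitiveLattices ϖ mul I r w, IsAdmissible ϖ e m (w - 1) Λ (i Λ) (j Λ) :=
    fun Λ hΛ => isAdmissible_of_mem_primitiveLattices hϖ hn hmul hm0 hmb hκ hΛ
  refine dvd_ncard_of_classes (finite_primitiveLattices hadic hϖ hn0)
    (fun Λ => unipotentOrbit (J Λ) Λ) (fun Λ _ => self_mem_unipotentOrbit _ Λ) ?_ ?_ ?_
  · rintro Λ hΛ _ ⟨u, hu, rfl⟩
    exact (hadm Λ hΛ).map_mem_primitiveLattices hϖ hn0 hmul hΛ hu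
  · intro Λ hΛ Γ hΓ
    have h := hadm Λ hΛ
    have hopen := isOpenLattice_of_mem_primitiveLattices hn0 hΛ
    have hJ : J Γ = J Λ := by
      obtain ⟨u, hu, rfl⟩ := hΓ
      have h1 : i (Λ.map (1 + u)) = i Λ := h.topIndex_map hϖ rfl hopen hu
      have h2 : j (Λ.map (1 + u)) = j Λ := h.tailIndex_map hϖ hκn rfl hopen hu
      have h3 := h.moveExp_map hϖ hopen hu
      simp only [J, h1, h2, h3]
    simp only [hJ]
    exact (h.isQuasiInvertible hϖ.not_isUnit).unipotentOrbit_eq hΓ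
  · intro Λ hΛ
    have := finite_quotient_range_lsmul (n := n) hadic hϖ ((n - 1) * I.sup r)
    refine (hadm Λ hΛ).pow_dvd_ncard hϖ
      (LinearMap.range (LinearMap.lsmul O (Fin n → O) (ϖ ^ ((n - 1) * I.sup r)))) ?_
      (range_lsmul_le_of_mem_primitiveLattices hn0 hΛ)
      (isOpenLattice_of_mem_primitiveLattices hn0 hΛ)
    rintro u _ ⟨x, rfl⟩
    exact ⟨u x, (map_smul u _ x).symm⟩
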